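/- Let $V,H$ be real Hilbert spaces forming a Gelfand triple $V\hookrightarrow H\cong H^*\hookrightarrow V^*$, where $V$ is dense in $H$ and the embedding $V\hookrightarrow H$ is compact. Let $a\colon V\times V\to\mathbb R$ be a continuous bilinear form satisfying Gårding's inequality $a(v,v)+\omega_0\|v\|_H^2\ge\alpha_0\|v\|_V^2$ for all $v\in V$, with some $\alpha_0>0$, $\omega_0\ge 0$, and define $A\colon V\to V^*$ by $\langle Ay,v\rangle=a(y,v)$. Let $(\omega,\varrho)$ be a measure space, $B\colon L^2(\omega)\to V^*$ linear and continuous, $y_0,y_d\in H$, $\delta_0>0$, and $u_a,u_b\in L^\infty(\omega)$ with $u_a<u_b$ a.e. Set $U_{ad}=\{u\in L^2(\omega): u_a\le u\le u_b \text{ a.e.}\}$, assumed bounded in $L^2(\omega)$ (automatic if $\varrho(\omega)<\infty$), and $U_{ad}(0,1)=\{u\in L^2((0,1);L^2(\omega)) : u(t)\in U_{ad}\text{ for a.e. }t\in(0,1)\}$. For $\nu>0$ and $u\in L^2((0,1);L^2(\omega))$ let $y=S(\nu,u)\in W(0,1)=L^2((0,1);V)\cap H^1((0,1);V^*)$ be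 the unique solution of $$\partial_t y+\nu Ay=\nu Bu\ \text{ in }(0,1),\qquad y(0)=y_0 .$$ Let $(\bar\nu,\bar u)$ be a solution of the transformed time-optimal problem: minimize $\nu$ over all $\nu>0$, $u\in U_{ad}(0,1)$ with $\|S(\nu,u)(1)-y_d\|_H\le\delta_0$; and set $\bar y=S(\bar\nu,\bar u)$. We say that the first-order optimality conditions hold in qualified form at $(\bar\nu,\bar u)$ if there is $\bar\mu>0$ such that, with $\bar\mu_0=1$, $$\int_0^1\langle B\bar u-A\bar y,\bar p\rangle\,dt=-\bar\mu_0,\qquad \int_0^1 (B^*\bar p,u-\bar u)_{L^2(\omega)}\,dt\ge 0\ \ \forall u\in U_{ad}(0,1),\qquad \|\bar y(1)-y_d\|_H=\delta_0,$$ where $\bar p\in W(0,1)$ solves $-\partial_t\bar p+\bar\nu A^*\bar p=0$, $\bar p(1)=\bar\mu(\bar y(1)-y_d)$. Let $\delta(\nu)=\inf_{u\in U_{ad}(0,1)}\|S(\nu,u)(1)-y_d\|_H-\delta_0$ be the minimal distance value function, and suppose that the integral $$\int_0^1\langle Bu-Ay,p\rangle\,dt,\qquad y=S(\bar\nu,u),\quad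 -\partial_t p+\bar\nu A^*p=0,\quad p(1)=\frac{y(1)-y_d}{\|y(1)-y_d\|_H},$$ has the same value for all minimizers $u$ of $\|S(\bar\nu,u)(1)-y_d\|_H$ over $U_{ad}(0,1)$. Then $\delta$ is differentiable at $\bar\nu$, and the first-order optimality conditions hold in qualified form at $(\bar\nu,\bar u)$ if and only if $\delta'(\bar\nu)\neq 0$. -/

import Mathlib

open MeasureTheory Set

noncomputable section

namespace TimeOptimal

/-- Lebesgue measure on the reference time interval `I = (0,1)`. -/
abbrev volI : Measure ℝ := volume.restrict (Ioo (0 : ℝ) 1)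

/-- The data of a parabolic control system: the Gelfand triple `V ↪ H ≅ H* ↪ V*` with compact
embedding `V ↪ H`, the bilinear form `a`, the control operator `B : L²(ω,ϱ) → V*`, the control
bounds, the initial state, the desired state and the radius of the target ball. -/
structure ControlSystem (V H : Type*)
    [NormedAddCommGroup V] [InnerProductSpace ℝ V]
    [NormedAddCommGroup H] [InnerProductSpace ℝ H]
    {Ω : Type*} [MeasurableSpace Ω] (ϱ : Measure Ω) where
  /-- the embedding `V ↪ H` -/
  ι : V →L[ℝ] H
  ι_injective : Function.Injective ι
  ι_dense : DenseRange ι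
  ι_compact : IsCompactOperator ι
  /-- the continuous bilinear form; `a y : V*` is `A y` and `a.flip p : V*` is `A* p` -/
  a : V →L[ℝ] V →L[ℝ] ℝ
  /-- Gårding's inequality -/
  garding : ∃ α₀ ω₀ : ℝ, 0 < α₀ ∧ 0 ≤ ω₀ ∧ ∀ v : V, α₀ * ‖v‖ ^ 2 ≤ a v v + ω₀ * ‖ι v‖ ^ 2
  /-- the control operator -/
  B : Lp ℝ 2 ϱ →L[ℝ] StrongDual ℝ V
  /-- lower control bound -/
  ua : Lp ℝ ⊤ ϱ
  /-- upper control bound -/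
  ub : Lp ℝ ⊤ ϱ
  ua_lt_ub : ∀ᵐ x ∂ϱ, ua x < ub x
  /-- initial state -/
  y₀ : H
  /-- desired state -/
  yd : H
  /-- radius of the target ball -/
  δ₀ : ℝ
  δ₀_pos : 0 < δ₀

variable {V H : Type*}
  [NormedAddCommGroup V] [InnerProductSpace ℝ V] [CompleteSpace V]
  [NormedAddCommGroup H] [InnerProductSpace ℝ H] [CompleteSpace H]
  {Ω : Type*} [MeasurableSpace Ω] {ϱ : Measure Ω}

/-- An element of `W(0,1) = L²(I;V) ∩ H¹(I;V*)`, given with its continuous `H`-valued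
representative on `[0,1]` and its weak derivative in `L²(I;V*)`. -/
structure Trajectory (ι : V →L[ℝ] H) where
  /-- the continuous `H`-valued representative (only its values on `[0,1]` matter) -/
  rep : ℝ → H
  /-- the function as an element of `L²(I;V)` -/
  val : ℝ → V
  /-- the weak time derivative in `L²(I;V*)` -/
  deriv : ℝ → StrongDual ℝ V
  continuousOn_rep : ContinuousOn rep (Icc 0 1)
  memLp_val : MemLp val 2 volI
  memLp_deriv : MemLp deriv 2 volI
  rep_eq_val : ∀ᵐ t ∂volI, rep t = ι (val t)
  /-- `rep`, viewed in `V*` through `h ↦ ⟨h, ι ·⟩`, is a primitive of `deriv` -/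
  rep_eq_integral : ∀ t ∈ Icc (0 : ℝ) 1,
    (innerSL ℝ (rep t)).comp ι = (innerSL ℝ (rep 0)).comp ι + ∫ s in (0 : ℝ)..t, deriv s

instance (ι : V →L[ℝ] H) : Nonempty (Trajectory ι) :=
  ⟨{ rep := fun _ => 0
     val := fun _ => 0
     deriv := fun _ => 0
     continuousOn_rep := continuousOn_const
     memLp_val := memLp_const 0
     memLp_deriv := memLp_const 0
     rep_eq_val := Filter.Eventually.of_forall fun _ => (map_zero ι).symm
     rep_eq_integral := fun t _ => by rw [intervalIntegral.integral_zero, add_zero] }⟩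

namespace ControlSystem

variable (P : ControlSystem V H ϱ)

/-- The admissible controls `U_ad ⊆ L²(ω)`. -/
def Uad : Set (Lp ℝ 2 ϱ) :=
  {u | ∀ᵐ x ∂ϱ, P.ua x ≤ u x ∧ u x ≤ P.ub x}

/-- The admissible controls `U_ad(0,1)` in `U(0,1) = L²((0,1) × ω) = L²((0,1); L²(ω))`. -/
def UadI : Set (Lp (Lp ℝ 2 ϱ) 2 volI) :=
  {u | ∀ᵐ t ∂volI, u t ∈ P.Uad}

/-- `y ∈ W(0,1)` solves `∂ₜ y + ν A y = ν B u`, `y(0) = y₀`. -/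
def IsState (ν : ℝ) (u : Lp (Lp ℝ 2 ϱ) 2 volI) (y : Trajectory P.ι) : Prop :=
  (∀ᵐ t ∂volI, y.deriv t + ν • P.a (y.val t) = ν • P.B (u t)) ∧ y.rep 0 = P.y₀

/-- The control-to-state map `S(ν,u)`: the (unique) solution of the transformed state equation. -/
def S (ν : ℝ) (u : Lp (Lp ℝ 2 ϱ) 2 volI) : Trajectory P.ι :=
  Classical.epsilon (P.IsState ν u)

/-- `p ∈ W(0,1)` solves `-∂ₜ p + ν A* p = 0`, `p(1) = p₁`. -/
def IsAdjoint (ν : ℝ) (p₁ : H) (p : Trajectory P.ι) : Prop :=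
  (∀ᵐ t ∂volI, -p.deriv t + ν • P.a.flip (p.val t) = 0) ∧ p.rep 1 = p₁

/-- The (unique) solution of the adjoint equation with terminal value `p₁`. -/
def adjointState (ν : ℝ) (p₁ : H) : Trajectory P.ι :=
  Classical.epsilon (P.IsAdjoint ν p₁)

/-- The adjoint control operator `B* : V → L²(ω)`, with `⟨B* v, w⟩ = (B w) v`. -/
def Badj (v : V) : Lp ℝ 2 ϱ :=
  (InnerProductSpace.toDual ℝ (Lp ℝ 2 ϱ)).symm (P.B.flip v)

/-- `∫₀¹ ⟨B u(t) - A y(t), p(t)⟩ dt` with `y = S(ν,u)`. -/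
def hamiltonian (ν : ℝ) (u : Lp (Lp ℝ 2 ϱ) 2 volI) (p : Trajectory P.ι) : ℝ :=
  ∫ t in Ioo (0 : ℝ) 1, (P.B (u t) - P.a ((P.S ν u).val t)) (p.val t)

/-- `f(ν,u) = ‖i₁ S(ν,u) - y_d‖ - δ₀`. -/
def f (ν : ℝ) (u : Lp (Lp ℝ 2 ϱ) 2 volI) : ℝ :=
  ‖(P.S ν u).rep 1 - P.yd‖ - P.δ₀

/-- `(ν,u)` is a solution of the transformed time-optimal problem: minimize `ν` over all
`(ν,u) ∈ ℝ₊ × U_ad(0,1)` with `‖i₁ S(ν,u) - y_d‖ ≤ δ₀`. -/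
def IsTimeOptimal (ν : ℝ) (u : Lp (Lp ℝ 2 ϱ) 2 volI) : Prop :=
  (0 < ν ∧ u ∈ P.UadI ∧ ‖(P.S ν u).rep 1 - P.yd‖ ≤ P.δ₀) ∧
    ∀ (ν' : ℝ) (u' : Lp (Lp ℝ 2 ϱ) 2 volI),
      0 < ν' → u' ∈ P.UadI → ‖(P.S ν' u').rep 1 - P.yd‖ ≤ P.δ₀ → ν ≤ ν'

/-- The minimal distance value function `δ(ν) = inf_{u ∈ U_ad(0,1)} ‖i₁ S(ν,u) - y_d‖ - δ₀`. -/
def delta (ν : ℝ) : ℝ :=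
  sInf (P.f ν '' P.UadI)

/-- The set `ū(ν)` of all distance-optimal controls for `ν`. -/
def distanceOptimal (ν : ℝ) : Set (Lp (Lp ℝ 2 ϱ) 2 volI) :=
  {u | u ∈ P.UadI ∧ ∀ u' ∈ P.UadI, ‖(P.S ν u).rep 1 - P.yd‖ ≤ ‖(P.S ν u').rep 1 - P.yd‖}

/-- The adjoint state with normalized terminal value `(y(1) - y_d)/‖y(1) - y_d‖`, `y = S(ν,u)`. -/
def normalizedAdjoint (ν : ℝ) (u : Lp (Lp ℝ 2 ϱ) 2 volI) : Trajectory P.ι :=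
  P.adjointState ν (‖(P.S ν u).rep 1 - P.yd‖⁻¹ • ((P.S ν u).rep 1 - P.yd))

/-- The value of `∫₀¹ ⟨B u - A y, p⟩ dt`, with `y = S(ν,u)` and the normalized adjoint state `p`,
is independent of the concrete minimizer `u ∈ ū(ν)`. -/
def ControlIndependent (ν : ℝ) : Prop :=
  ∀ u₁ ∈ P.distanceOptimal ν, ∀ u₂ ∈ P.distanceOptimal ν,
    P.hamiltonian ν u₁ (P.normalizedAdjoint ν u₁) =
      P.hamiltonian ν u₂ (P.normalizedAdjoint ν u₂)

/-- The first order optimality conditions for `(ν,u)` with multipliers `μ` and `μ₀`; the adjoint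
state has terminal value `μ (y(1) - y_d)`, where `y = S(ν,u)`. -/
structure OptimalityConditions (ν : ℝ) (u : Lp (Lp ℝ 2 ϱ) 2 volI) (μ μ₀ : ℝ) : Prop where
  hamiltonian_eq :
    P.hamiltonian ν u (P.adjointState ν (μ • ((P.S ν u).rep 1 - P.yd))) = -μ₀
  variational_inequality : ∀ u' ∈ P.UadI,
    0 ≤ ∫ t in Ioo (0 : ℝ) 1,
      inner ℝ (P.Badj ((P.adjointState ν (μ • ((P.S ν u).rep 1 - P.yd))).val t)) (u' t - u t)
  terminal_eq : ‖(P.S ν u).rep 1 - P.yd‖ = P.δ₀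

/-- The first order optimality conditions hold in qualified form, i.e. with some `μ > 0` and
`μ₀ = 1`. -/
def QualifiedConditions (ν : ℝ) (u : Lp (Lp ℝ 2 ϱ) 2 volI) : Prop :=
  ∃ μ : ℝ, 0 < μ ∧ P.OptimalityConditions ν u μ 1

end ControlSystem

end TimeOptimal

end

noncomputable section

set_option linter.unusedSectionVars false

namespace TimeOptimal

/-! ### Square integrable functions with values in a Hilbert space -/

section SquareIntegrable

open Filter Topology

variable {α : Type*} {mα : MeasurableSpace α} {μ : Measure α}
  {E : Type*} [NormedAddCommGroup E] [InnerProductSpace ℝ E]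

/-! The theorem is Danskin's formula for `delta` at the optimal time, followed by a rescaling of the
adjoint state.

Optimality forces every admissible control to stay at distance at least `δ₀` for the parameter
`νbar`, since a strictly smaller distance would survive a small decrease of the parameter. Hence
`ubar` minimizes the distance and its terminal residual has norm exactly `δ₀ > 0`, which makes the
distance smooth there. All minimizers have the same residual, because they realize the projection of
zero onto a convex set. They therefore share one normalized adjoint state `p`. With `p` frozen, the
Hamiltonian integral is a continuous affine functional `G` of the control, constant on minimizers by
hypothesis. A compactness argument makes `G` nearly constant on near-minimizers, and first-order
expansions of the distance in `ν` then give `delta' = G ubar` (`hasDerivAt_sInf_image`,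
`hasDerivAt_delta`).

The adjoint equation is linear, so the terminal value `μ (y(1) - yd)` yields the Hamiltonian
integral `μ δ₀ delta'`, and the first qualified condition reads `μ δ₀ delta' = -1`. Since `delta` is
nonnegative to the left of `νbar` and nonpositive at it, `delta' ≤ 0`. A positive `μ` thus exists
exactly when `delta' ≠ 0`. The variational inequality is, by duality, the projection inequality, and
holds for every positive `μ`.

The states are chosen by `Classical.epsilon`, so well-posedness has to be established as well.
Energy estimates give uniqueness and show that the solvable data form a closed subspace; testing
with exponentially weighted averages shows that its orthogonal complement is zero. Both rest on
integration by parts in `W(0,1)`, obtained from difference quotients. -/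

theorem inner_toLp {f g : α → E} (hf : MemLp f 2 μ) (hg : MemLp g 2 μ) :
    inner ℝ (hf.toLp f) (hg.toLp g) = ∫ x, inner ℝ (f x) (g x) ∂μ := by
  rw [L2.inner_def]
  refine integral_congr_ae ?_
  filter_upwards [hf.coeFn_toLp, hg.coeFn_toLp] with x h1 h2
  rw [h1, h2]

theorem integrable_inner_of_memLp {f g : α → E} (hf : MemLp f 2 μ) (hg : MemLp g 2 μ) :
    Integrable (fun x => inner ℝ (f x) (g x)) μ := by
  refine (L2.integrable_inner (𝕜 := ℝ) (hf.toLp f) (hg.toLp g)).congr ?_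
  filter_upwards [hf.coeFn_toLp, hg.coeFn_toLp] with x h1 h2
  rw [h1, h2]

theorem norm_sq_Lp (f : Lp E 2 μ) : ‖f‖ ^ 2 = ∫ x, ‖f x‖ ^ 2 ∂μ := by
  rw [← real_inner_self_eq_norm_sq, L2.inner_def]
  exact integral_congr_ae (Eventually.of_forall fun x => real_inner_self_eq_norm_sq _)

theorem norm_sq_toLp {f : α → E} (hf : MemLp f 2 μ) : ‖hf.toLp f‖ ^ 2 = ∫ x, ‖f x‖ ^ 2 ∂μ := by
  rw [← real_inner_self_eq_norm_sq, inner_toLp]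
  exact integral_congr_ae (Eventually.of_forall fun x => real_inner_self_eq_norm_sq _)

variable {F W : ℝ → E}

theorem memLp_comp_add_right {X : Type*} [NormedAddCommGroup X] {F : ℝ → X} (hF : MemLp F 2 volume) (s : ℝ) :
    MemLp (fun r => F (r + s)) 2 volume :=
  hF.comp_measurePreserving (measurePreserving_add_right volume s)

theorem norm_toLp_comp_add_right (hF : MemLp F 2 volume) (s : ℝ) :
    ‖(memLp_comp_add_right hF s).toLp (fun r => F (r + s))‖ = ‖hF.toLp F‖ := by
  rw [Lp.norm_toLp, Lp.norm_toLp]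
  congr 1
  exact eLpNorm_comp_measurePreserving hF.1 (measurePreserving_add_right volume s)

/-- Translation is strongly continuous on `L²`. Continuity of this correlation function is what
allows its primitive to be differentiated at zero. -/
theorem continuous_integral_inner_translate (hF : MemLp F 2 volume) (hW : MemLp W 2 volume) :
    Continuous fun s : ℝ => ∫ r, inner ℝ (F (r + s)) (W r) := by
  let g : C(ℝ, C(ℝ, ℝ)) := (ContinuousMap.mk (fun a : ℝ × ℝ => a.2 + a.1) (by fun_prop)).curry
  have hg : ∀ s, MeasurePreserving (g s) volume volume := fun s =>
    measurePreserving_add_right volume s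
  have key : Continuous fun s : ℝ => Lp.compMeasurePreserving (g s) (hg s) (hF.toLp F) :=
    continuous_const.compMeasurePreservingLp g.continuous hg (by simp)
  have h2 := (key.inner (𝕜 := ℝ) (continuous_const (y := hW.toLp W)))
  convert h2 using 2 with s
  rw [Lp.toLp_compMeasurePreserving hF (hg s), inner_toLp]
  rfl

theorem aestronglyMeasurable_translate_prod (hF : AEStronglyMeasurable F volume)
    (ν : Measure ℝ) [SFinite ν] :
    AEStronglyMeasurable (fun z : ℝ × ℝ => F (z.2 + z.1)) (ν.prod volume) := by
  refine hF.comp_quasiMeasurePreserving ⟨by fun_prop, ?_⟩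
  refine Measure.AbsolutelyContinuous.mk fun s hs h0 => ?_
  rw [Measure.map_apply (by fun_prop) hs, Measure.measure_prod_null (by measurability)]
  refine Eventually.of_forall fun a => ?_
  have h1 : Prod.mk a ⁻¹' ((fun z : ℝ × ℝ => z.2 + z.1) ⁻¹' s) = (fun b => b + a) ⁻¹' s := rfl
  simp only [h1, measure_preimage_add_right, h0, Pi.zero_apply]

theorem integrable_inner_translate_prod (hF : MemLp F 2 volume) (hW : MemLp W 2 volume)
    (ν : Measure ℝ) [IsFiniteMeasure ν] :
    Integrable (fun z : ℝ × ℝ => inner ℝ (F (z.2 + z.1)) (W z.2)) (ν.prod volume) := by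
  have hmeas : AEStronglyMeasurable (fun z : ℝ × ℝ => inner ℝ (F (z.2 + z.1)) (W z.2))
      (ν.prod volume) :=
    (aestronglyMeasurable_translate_prod hF.1 ν).inner hW.1.comp_snd
  rw [integrable_prod_iff hmeas]
  refine ⟨Eventually.of_forall fun s =>
    integrable_inner_of_memLp (memLp_comp_add_right hF s) hW, ?_⟩
  refine Integrable.of_bound hmeas.norm.integral_prod_right' (‖hF.toLp F‖ ^ 2 + ‖hW.toLp W‖ ^ 2)
    (Eventually.of_forall fun s => ?_)
  rw [Real.norm_of_nonneg (integral_nonneg fun _ => norm_nonneg _),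
    ← norm_toLp_comp_add_right hF s, norm_sq_toLp, norm_sq_toLp, ← integral_add]
  · refine integral_mono ?_ ?_ fun r => ?_
    · exact (integrable_inner_of_memLp (memLp_comp_add_right hF s) hW).norm
    · exact (memLp_two_iff_integrable_sq_norm (memLp_comp_add_right hF s).1).1
        (memLp_comp_add_right hF s) |>.add ((memLp_two_iff_integrable_sq_norm hW.1).1 hW)
    · have := norm_inner_le_norm (𝕜 := ℝ) (F (r + s)) (W r)
      simp only
      nlinarith [sq_nonneg (‖F (r + s)‖ - ‖W r‖), sq_nonneg (‖F (r + s)‖ + ‖W r‖)]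
  · exact (memLp_two_iff_integrable_sq_norm (memLp_comp_add_right hF s).1).1
        (memLp_comp_add_right hF s)
  · exact (memLp_two_iff_integrable_sq_norm hW.1).1 hW

theorem intervalIntegrable_of_memLp {X : Type*} [NormedAddCommGroup X] {F : ℝ → X}
    (hF : MemLp F 2 volume) (a b : ℝ) :
    IntervalIntegrable F volume a b := by
  rw [intervalIntegrable_iff]
  have : IsFiniteMeasure (volume.restrict (uIoc a b)) :=
    ⟨by rw [Measure.restrict_apply_univ, uIoc]; exact measure_Ioc_lt_top⟩
  exact (hF.restrict (uIoc a b)).integrable (by norm_num)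

/-- Steklov averages converge weakly in `L²`. -/
theorem tendsto_integral_inner_steklov [CompleteSpace E]
    (hF : MemLp F 2 volume) (hW : MemLp W 2 volume) :
    Tendsto (fun h : ℝ => h⁻¹ * ∫ r, inner ℝ (∫ s in r..r + h, F s) (W r)) (𝓝[≠] 0)
      (𝓝 (∫ r, inner ℝ (F r) (W r))) := by
  have hc := continuous_integral_inner_translate hF hW
  -- By Fubini, the averaged pairing is the mean over `[0,h]` of the translation correlation, so its
  -- limit is the derivative of a primitive at zero.
  have hd : HasDerivAt (fun h : ℝ => ∫ s in (0 : ℝ)..h, ∫ r, inner ℝ (F (r + s)) (W r))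
      (∫ r, inner ℝ (F (r + 0)) (W r)) 0 :=
    intervalIntegral.integral_hasDerivAt_right (hc.intervalIntegrable 0 0)
      (hc.stronglyMeasurableAtFilter _ _) hc.continuousAt
  have hs := hasDerivAt_iff_tendsto_slope_zero.1 hd
  simp only [zero_add, add_zero, intervalIntegral.integral_same, sub_zero, smul_eq_mul] at hs
  refine hs.congr fun h => ?_
  congr 1
  have : IsFiniteMeasure (volume.restrict (uIoc 0 h)) :=
    ⟨by rw [Measure.restrict_apply_univ, uIoc]; exact measure_Ioc_lt_top⟩
  rw [intervalIntegral_integral_swap (integrable_inner_translate_prod hF hW _)]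
  refine integral_congr_ae (Eventually.of_forall fun r => ?_)
  have h1 : ∫ s in r..r + h, F s = ∫ s in (0 : ℝ)..h, F (r + s) := by
    rw [intervalIntegral.integral_comp_add_left, add_zero]
  have h2 : IntervalIntegrable (fun s => F (r + s)) volume 0 h := by
    have := memLp_comp_add_right hF r
    simp_rw [add_comm _ r] at this
    exact intervalIntegrable_of_memLp this _ _
  simp only
  rw [h1, real_inner_comm]
  have h3 := (innerSL ℝ (W r)).intervalIntegral_comp_comm h2
  simp only [innerSL_apply_apply] at h3
  rw [← h3]
  exact intervalIntegral.integral_congr fun s _ => real_inner_comm _ _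

end SquareIntegrable

/-! ### Integration by parts for trajectories -/

section IntegrationByParts

open Filter Topology

variable {V H : Type*}
  [NormedAddCommGroup V] [InnerProductSpace ℝ V] [CompleteSpace V]
  [NormedAddCommGroup H] [InnerProductSpace ℝ H] [CompleteSpace H]

/-- The Riesz isomorphism `V* ≃ V`. -/
abbrev riesz (V : Type*) [NormedAddCommGroup V] [InnerProductSpace ℝ V] [CompleteSpace V] :
    StrongDual ℝ V ≃ₗᵢ[ℝ] V :=
  (InnerProductSpace.toDual ℝ V).symm

theorem inner_riesz (f : StrongDual ℝ V) (v : V) : inner ℝ (riesz V f) v = f v :=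
  InnerProductSpace.toDual_symm_apply

variable {α : Type*} {mα : MeasurableSpace α} {μ : Measure α}

theorem memLp_riesz {f : α → StrongDual ℝ V} (hf : MemLp f 2 μ) :
    MemLp (fun x => riesz V (f x)) 2 μ :=
  (riesz V).toContinuousLinearEquiv.toContinuousLinearMap.comp_memLp' hf

theorem memLp_toDual {f : α → V} (hf : MemLp f 2 μ) :
    MemLp (fun x => InnerProductSpace.toDual ℝ V (f x)) 2 μ :=
  (InnerProductSpace.toDual ℝ V).toContinuousLinearEquiv.toContinuousLinearMap.comp_memLp' hf

theorem integrable_dual_apply {f : α → StrongDual ℝ V} {v : α → V} (hf : MemLp f 2 μ)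
    (hv : MemLp v 2 μ) : Integrable (fun x => f x (v x)) μ := by
  simpa only [inner_riesz] using integrable_inner_of_memLp (memLp_riesz hf) hv

theorem tendsto_integral_dual_steklov {F : ℝ → StrongDual ℝ V} {W : ℝ → V}
    (hF : MemLp F 2 volume) (hW : MemLp W 2 volume) :
    Tendsto (fun h : ℝ => h⁻¹ * ∫ r, (∫ s in r..r + h, F s) (W r)) (𝓝[≠] 0)
      (𝓝 (∫ r, F r (W r))) := by
  have := tendsto_integral_inner_steklov (memLp_riesz hF) hW
  simp only [inner_riesz] at this
  refine this.congr fun h => ?_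
  congr 2
  ext r
  have h1 := (riesz V).toContinuousLinearEquiv.toContinuousLinearMap.intervalIntegral_comp_comm
    (intervalIntegrable_of_memLp hF r (r + h))
  simp only [ContinuousLinearEquiv.coe_coe, LinearIsometryEquiv.coe_toContinuousLinearEquiv] at h1
  rw [h1, inner_riesz]

theorem volI_eq_restrict_Ioc : volI = volume.restrict (Ioc (0 : ℝ) 1) :=
  restrict_Ioo_eq_restrict_Ioc

theorem measurePreserving_one_sub : MeasurePreserving (fun t : ℝ => 1 - t) volI volI := by
  have h := (Measure.measurePreserving_sub_left (volume : Measure ℝ) 1).restrict_preimage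
    (measurableSet_Ioo (a := (0 : ℝ)) (b := 1))
  have : (fun t : ℝ => 1 - t) ⁻¹' Ioo 0 1 = Ioo 0 1 := by simp
  rwa [this] at h

theorem setIntegral_Ioo_eq_intervalIntegral {E : Type*} [NormedAddCommGroup E] [NormedSpace ℝ E]
    (f : ℝ → E) : ∫ t in Ioo (0 : ℝ) 1, f t = ∫ t in (0 : ℝ)..1, f t := by
  rw [intervalIntegral.integral_of_le zero_le_one, restrict_Ioo_eq_restrict_Ioc]

theorem memLp_indicator_Ioc {E : Type*} [NormedAddCommGroup E] {f : ℝ → E} {T : ℝ}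
    (hT : T ≤ 1) (hf : MemLp f 2 volI) : MemLp ((Ioc 0 T).indicator f) 2 volume := by
  rw [memLp_indicator_iff_restrict measurableSet_Ioc]
  rw [volI_eq_restrict_Ioc] at hf
  exact hf.mono_measure (Measure.restrict_mono (Ioc_subset_Ioc_right hT) le_rfl)

theorem intervalIntegral_indicator_Ioc {E : Type*} [NormedAddCommGroup E] [NormedSpace ℝ E]
    {f : ℝ → E} {T : ℝ} (hT : 0 ≤ T) (x : ℝ) :
    ∫ s in (0 : ℝ)..x, (Ioc 0 T).indicator f s = ∫ s in (0 : ℝ)..max 0 (min x T), f s := by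
  rcases le_total x 0 with hx | hx
  · rw [max_eq_left ((min_le_left _ _).trans hx), intervalIntegral.integral_same,
      intervalIntegral.integral_of_ge hx, setIntegral_indicator measurableSet_Ioc]
    have : Ioc x 0 ∩ Ioc 0 T = ∅ := by
      ext s; simp only [mem_inter_iff, mem_Ioc, mem_empty_iff_false, iff_false]
      intro h; linarith [h.1.2, h.2.1]
    simp [this]
  · rw [max_eq_right (le_min hx hT), intervalIntegral.integral_of_le hx,
      intervalIntegral.integral_of_le (le_min hx hT), setIntegral_indicator measurableSet_Ioc]
    simp [Ioc_inter_Ioc]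

namespace Trajectory

variable {ι : V →L[ℝ] H}

theorem intervalIntegrable_deriv (y : Trajectory ι) {a b : ℝ} (ha : a ∈ Icc (0 : ℝ) 1)
    (hb : b ∈ Icc (0 : ℝ) 1) : IntervalIntegrable y.deriv volume a b := by
  rw [intervalIntegrable_iff]
  have h1 : Integrable y.deriv volI := y.memLp_deriv.integrable (by norm_num)
  rw [volI_eq_restrict_Ioc] at h1
  exact IntegrableOn.mono_set h1 (Ioc_subset_Ioc (le_min ha.1 hb.1) (max_le ha.2 hb.2))

/-- Extension of the continuous representative by constants outside `[0,T]`. -/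
def extend (y : Trajectory ι) (T r : ℝ) : H := y.rep (max 0 (min r T))

theorem continuous_extend (y : Trajectory ι) {T : ℝ} (hT : T ∈ Icc (0 : ℝ) 1) :
    Continuous (y.extend T) :=
  y.continuousOn_rep.comp_continuous (by fun_prop) fun r =>
    ⟨le_max_left _ _, max_le zero_le_one ((min_le_right _ _).trans hT.2)⟩

theorem extend_of_mem (y : Trajectory ι) {T r : ℝ} (hr : r ∈ Icc 0 T) : y.extend T r = y.rep r := by
  rw [extend, min_eq_left hr.2, max_eq_right hr.1]

theorem extend_of_nonpos (y : Trajectory ι) {T r : ℝ} (hr : r ≤ 0) : y.extend T r = y.rep 0 := by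
  rw [extend, max_eq_left ((min_le_left _ _).trans hr)]

theorem extend_of_le (y : Trajectory ι) {T r : ℝ} (hT : 0 ≤ T) (hr : T ≤ r) :
    y.extend T r = y.rep T := by
  rw [extend, min_eq_right hr, max_eq_right hT]

/-- Extending the derivative by zero outside `(0,T]` corresponds to extending the representative by
constants. This avoids boundary cases when translating. -/
theorem integral_indicator_deriv_apply (y : Trajectory ι) {T : ℝ} (hT : T ∈ Icc (0 : ℝ) 1)
    (a b : ℝ) (v : V) :
    (∫ s in a..b, (Ioc 0 T).indicator y.deriv s) v = inner ℝ (y.extend T b - y.extend T a) (ι v) := by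
  have hint := intervalIntegrable_of_memLp (memLp_indicator_Ioc hT.2 y.memLp_deriv)
  have key : ∀ x, (∫ s in (0 : ℝ)..x, (Ioc 0 T).indicator y.deriv s) v =
      inner ℝ (y.extend T x - y.rep 0) (ι v) := by
    intro x
    rw [intervalIntegral_indicator_Ioc hT.1]
    have h1 := y.rep_eq_integral (max 0 (min x T))
      ⟨le_max_left _ _, max_le zero_le_one ((min_le_right _ _).trans hT.2)⟩
    have h2 := congrArg (fun φ : StrongDual ℝ V => φ v) h1
    simp only [ContinuousLinearMap.comp_apply, innerSL_apply_apply, add_apply] at h2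
    rw [inner_sub_left, extend, h2]
    ring
  rw [← intervalIntegral.integral_interval_sub_left (hint 0 b) (hint 0 a), sub_apply,
    key, key, ← inner_sub_left]
  congr 1
  abel

/-- For fixed step the quotient pairs in `H`. It is also a Steklov average of the `V*`-valued
derivative tested against `z.val`, so the limit is the duality pairing of `V*` and `V`. -/
theorem tendsto_difference_quotient (y z : Trajectory ι) {T : ℝ} (hT : T ∈ Icc (0 : ℝ) 1) :
    Tendsto (fun h : ℝ => h⁻¹ * ∫ r in (0 : ℝ)..T,
      inner ℝ (y.extend T (r + h) - y.extend T r) (z.extend T r)) (𝓝[≠] 0)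
      (𝓝 (∫ r in (0 : ℝ)..T, y.deriv r (z.val r))) := by
  have h1 := tendsto_integral_dual_steklov (memLp_indicator_Ioc hT.2 y.memLp_deriv)
    (memLp_indicator_Ioc hT.2 z.memLp_val)
  have hval : ∀ᵐ r ∂(volume.restrict (Ioc 0 T)), z.rep r = ι (z.val r) := by
    have := z.rep_eq_val
    rw [volI_eq_restrict_Ioc] at this
    exact ae_mono (Measure.restrict_mono (Ioc_subset_Ioc_right hT.2) le_rfl) this
  convert h1 using 2 with h
  · congr 1
    rw [intervalIntegral.integral_of_le hT.1, ← integral_indicator measurableSet_Ioc]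
    rw [ae_restrict_iff' measurableSet_Ioc] at hval
    refine integral_congr_ae ?_
    filter_upwards [hval] with r hr
    rw [y.integral_indicator_deriv_apply hT]
    by_cases hm : r ∈ Ioc 0 T
    · rw [indicator_of_mem hm, indicator_of_mem hm, z.extend_of_mem (Ioc_subset_Icc_self hm), hr hm]
    · rw [indicator_of_notMem hm, indicator_of_notMem hm, map_zero, inner_zero_right]
  · rw [intervalIntegral.integral_of_le hT.1, ← integral_indicator measurableSet_Ioc]
    congr 1
    ext r
    by_cases hm : r ∈ Ioc 0 T
    · simp only [indicator_of_mem hm]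
    · simp only [indicator_of_notMem hm, map_zero]

theorem tendsto_average_nhdsNE {q : ℝ → ℝ} (hq : Continuous q) (a : ℝ) :
    Tendsto (fun h : ℝ => h⁻¹ * ∫ r in a..a + h, q r) (𝓝[≠] 0) (𝓝 (q a)) := by
  have hd : HasDerivAt (fun x : ℝ => ∫ r in a..x, q r) (q a) a :=
    intervalIntegral.integral_hasDerivAt_right (hq.intervalIntegrable _ _)
      (hq.stronglyMeasurableAtFilter _ _) hq.continuousAt
  simpa using hasDerivAt_iff_tendsto_slope_zero.1 hd

theorem tendsto_neg_nhdsGT : Tendsto (fun h : ℝ => -h) (𝓝[>] 0) (𝓝[≠] 0) := by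
  refine tendsto_nhdsWithin_iff.2 ⟨?_, ?_⟩
  · have : Tendsto (fun h : ℝ => -h) (𝓝 0) (𝓝 (-0)) := (continuous_neg).tendsto 0
    rw [neg_zero] at this
    exact this.mono_left nhdsWithin_le_nhds
  · filter_upwards [self_mem_nhdsWithin] with h hh
    exact neg_ne_zero.2 (ne_of_gt hh)

/-- Discrete summation by parts: with a backward quotient for `y` and a forward one for `z`, the
diagonal terms cancel and the shifted products differ only near the two ends. There they are
averages of continuous functions and converge to the boundary terms. -/
theorem integral_by_parts (y z : Trajectory ι) {T : ℝ} (hT : T ∈ Icc (0 : ℝ) 1) :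
    inner ℝ (y.rep T) (z.rep T) - inner ℝ (y.rep 0) (z.rep 0) =
      (∫ s in (0 : ℝ)..T, y.deriv s (z.val s)) + ∫ s in (0 : ℝ)..T, z.deriv s (y.val s) := by
  have hy := y.continuous_extend hT
  have hz := z.continuous_extend hT
  have hne : 𝓝[>] (0 : ℝ) ≤ 𝓝[≠] 0 := nhdsWithin_mono _ fun x hx => ne_of_gt hx
  have h1 := ((y.tendsto_difference_quotient z hT).comp tendsto_neg_nhdsGT).add
    ((z.tendsto_difference_quotient y hT).mono_left hne)
  have h2 := ((tendsto_average_nhdsNE (q := fun r => inner ℝ (y.extend T r) (z.rep T))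
    (by fun_prop) T).comp tendsto_neg_nhdsGT).sub ((tendsto_average_nhdsNE
      (q := fun r => inner ℝ (y.rep 0) (z.extend T r)) (by fun_prop) 0).mono_left hne)
  simp only [y.extend_of_le hT.1 le_rfl, z.extend_of_nonpos le_rfl] at h2
  refine tendsto_nhds_unique h2 (h1.congr' ?_)
  filter_upwards [self_mem_nhdsWithin] with h hh
  have hh : 0 < h := hh
  have hk : Continuous fun r => inner ℝ (y.extend T r) (z.extend T (r + h)) := by fun_prop
  have e1 : ∫ r in (0 : ℝ)..T, inner ℝ (y.extend T (r + -h) - y.extend T r) (z.extend T r) =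
      (∫ r in (-h)..(T - h), inner ℝ (y.extend T r) (z.extend T (r + h))) -
        ∫ r in (0 : ℝ)..T, inner ℝ (y.extend T r) (z.extend T r) := by
    simp only [inner_sub_left]
    rw [intervalIntegral.integral_sub (Continuous.intervalIntegrable (by fun_prop) _ _)
      (Continuous.intervalIntegrable (by fun_prop) _ _)]
    congr 1
    have := intervalIntegral.integral_comp_sub_right
      (fun r => inner ℝ (y.extend T r) (z.extend T (r + h))) h (a := 0) (b := T)
    simp only [sub_add_cancel, zero_sub] at this
    rw [← this]
    simp only [sub_eq_add_neg]
  have e2 : ∫ r in (0 : ℝ)..T, inner ℝ (z.extend T (r + h) - z.extend T r) (y.extend T r) =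
      (∫ r in (0 : ℝ)..T, inner ℝ (y.extend T r) (z.extend T (r + h))) -
        ∫ r in (0 : ℝ)..T, inner ℝ (y.extend T r) (z.extend T r) := by
    simp only [inner_sub_left]
    rw [intervalIntegral.integral_sub (Continuous.intervalIntegrable (by fun_prop) _ _)
      (Continuous.intervalIntegrable (by fun_prop) _ _)]
    simp only [real_inner_comm]
  have e3 : ∫ r in T..T + -h, inner ℝ (y.extend T r) (z.rep T) =
      -∫ r in (T - h)..T, inner ℝ (y.extend T r) (z.extend T (r + h)) := by
    rw [intervalIntegral.integral_symm, ← sub_eq_add_neg]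
    congr 1
    refine intervalIntegral.integral_congr fun r hr => ?_
    rw [uIcc_of_le (by linarith)] at hr
    rw [z.extend_of_le hT.1 (by linarith [hr.1])]
  have e4 : ∫ r in (0 : ℝ)..0 + h, inner ℝ (y.rep 0) (z.extend T r) =
      ∫ r in (-h)..0, inner ℝ (y.extend T r) (z.extend T (r + h)) := by
    have := intervalIntegral.integral_comp_add_right
      (fun r => inner ℝ (y.rep 0) (z.extend T r)) h (a := -h) (b := 0)
    rw [neg_add_cancel] at this
    rw [← this]
    refine intervalIntegral.integral_congr fun r hr => ?_
    rw [uIcc_of_le (by linarith)] at hr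
    rw [y.extend_of_nonpos hr.2]
  have e5 := intervalIntegral.integral_add_adjacent_intervals
    (hk.intervalIntegrable (-h) (T - h) (μ := volume)) (hk.intervalIntegrable (T - h) T)
  have e6 := intervalIntegral.integral_add_adjacent_intervals
    (hk.intervalIntegrable (-h) 0 (μ := volume)) (hk.intervalIntegrable 0 T)
  simp only [Function.comp_apply]
  rw [e1, e2, e3, e4, inv_neg]
  linear_combination h⁻¹ * (e6 - e5)

end Trajectory

end IntegrationByParts

/-! ### Energy estimates -/

section Energy

open Filter Topology

variable {V H : Type*}
  [NormedAddCommGroup V] [InnerProductSpace ℝ V] [CompleteSpace V]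
  [NormedAddCommGroup H] [InnerProductSpace ℝ H] [CompleteSpace H]

/-- Gårding's inequality for a bilinear form, with fixed constants. -/
def IsGarding (ι : V →L[ℝ] H) (b : V →L[ℝ] V →L[ℝ] ℝ) (α ω : ℝ) : Prop :=
  ∀ v : V, α * ‖v‖ ^ 2 ≤ b v v + ω * ‖ι v‖ ^ 2

/-- Gronwall in integral form: the right-hand side is differentiable with derivative `c φ`, at most
`c` times itself, so the differential form applies to it. Clamping the argument to `[0,1]` makes `φ`
continuous on the line. -/
theorem le_mul_exp_of_le_integral {φ : ℝ → ℝ} {K c : ℝ} (hφ : ContinuousOn φ (Icc 0 1))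
    (hφ0 : ∀ t ∈ Icc (0 : ℝ) 1, 0 ≤ φ t) (hc : 0 ≤ c)
    (h : ∀ t ∈ Icc (0 : ℝ) 1, φ t ≤ K + c * ∫ s in (0 : ℝ)..t, φ s) :
    ∀ t ∈ Icc (0 : ℝ) 1, φ t ≤ K * Real.exp (c * t) := by
  let ψ : ℝ → ℝ := fun r => φ (max 0 (min r 1))
  have hψ : Continuous ψ := hφ.comp_continuous (by fun_prop) fun r =>
    ⟨le_max_left _ _, max_le zero_le_one (min_le_right _ _)⟩
  have hψφ : ∀ t ∈ Icc (0 : ℝ) 1, ψ t = φ t := fun t ht => by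
    simp only [ψ, min_eq_left ht.2, max_eq_right ht.1]
  have hint : ∀ t ∈ Icc (0 : ℝ) 1, ∫ s in (0 : ℝ)..t, φ s = ∫ s in (0 : ℝ)..t, ψ s := by
    intro t ht
    refine intervalIntegral.integral_congr fun s hs => ?_
    rw [uIcc_of_le ht.1] at hs
    exact (hψφ s ⟨hs.1, hs.2.trans ht.2⟩).symm
  let Φ : ℝ → ℝ := fun t => K + c * ∫ s in (0 : ℝ)..t, ψ s
  have hΦ : ∀ t, HasDerivAt Φ (c * ψ t) t := fun t =>
    ((intervalIntegral.integral_hasDerivAt_right (hψ.intervalIntegrable _ _)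
      (hψ.stronglyMeasurableAtFilter _ _) hψ.continuousAt).const_mul c).const_add K
  have hle : ∀ t ∈ Icc (0 : ℝ) 1, φ t ≤ Φ t := fun t ht => by
    simpa only [Φ, ← hint t ht] using h t ht
  have hK : 0 ≤ K := by
    have h0 : (0 : ℝ) ∈ Icc (0 : ℝ) 1 := ⟨le_rfl, zero_le_one⟩
    simpa [Φ] using (hφ0 0 h0).trans (hle 0 h0)
  have hgr := norm_le_gronwallBound_of_norm_deriv_right_le (f := Φ) (f' := fun t => c * ψ t)
    (δ := K) (K := c) (ε := 0) (a := 0) (b := 1)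
    (fun t _ => (hΦ t).continuousAt.continuousWithinAt) (fun t _ => (hΦ t).hasDerivWithinAt)
    (by simp [Φ, abs_of_nonneg hK]) (by
      intro t ht
      have ht' := Ico_subset_Icc_self ht
      have h1 := hφ0 t ht'
      have h2 := hle t ht'
      rw [hψφ t ht', Real.norm_of_nonneg (mul_nonneg hc h1), Real.norm_of_nonneg (h1.trans h2),
        add_zero]
      exact mul_le_mul_of_nonneg_left h2 hc)
  intro t ht
  have := hgr t ht
  rw [gronwallBound_ε0, sub_zero] at this
  exact (hle t ht).trans ((le_abs_self _).trans this)

namespace Trajectory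

variable {ι : V →L[ℝ] H}

/-- The linear combination `c y + d z` of two trajectories. -/
def comb (c : ℝ) (y : Trajectory ι) (d : ℝ) (z : Trajectory ι) : Trajectory ι where
  rep t := c • y.rep t + d • z.rep t
  val t := c • y.val t + d • z.val t
  deriv t := c • y.deriv t + d • z.deriv t
  continuousOn_rep := (y.continuousOn_rep.const_smul c).add (z.continuousOn_rep.const_smul d)
  memLp_val := (y.memLp_val.const_smul c).add (z.memLp_val.const_smul d)
  memLp_deriv := (y.memLp_deriv.const_smul c).add (z.memLp_deriv.const_smul d)
  rep_eq_val := by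
    filter_upwards [y.rep_eq_val, z.rep_eq_val] with t h1 h2
    simp only [h1, h2, map_add, map_smul]
  rep_eq_integral t ht := by
    have h0 : (0 : ℝ) ∈ Icc (0 : ℝ) 1 := ⟨le_rfl, zero_le_one⟩
    have h3 : ∫ s in (0 : ℝ)..t, c • y.deriv s + d • z.deriv s =
        (∫ s in (0 : ℝ)..t, c • y.deriv s) + ∫ s in (0 : ℝ)..t, d • z.deriv s :=
      intervalIntegral.integral_add ((y.intervalIntegrable_deriv h0 ht).smul c)
        ((z.intervalIntegrable_deriv h0 ht).smul d)
    rw [h3, intervalIntegral.integral_smul, intervalIntegral.integral_smul]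
    have h1 := y.rep_eq_integral t ht
    have h2 := z.rep_eq_integral t ht
    simp only [map_add, map_smul, ContinuousLinearMap.add_comp, ContinuousLinearMap.smul_comp] at *
    rw [h1, h2]
    module

/-- The trajectory obtained by reversing time. -/
def reverse (y : Trajectory ι) : Trajectory ι where
  rep t := y.rep (1 - t)
  val t := y.val (1 - t)
  deriv t := -y.deriv (1 - t)
  continuousOn_rep := y.continuousOn_rep.comp (by fun_prop) fun t ht =>
    ⟨by linarith [ht.2], by linarith [ht.1]⟩
  memLp_val := y.memLp_val.comp_measurePreserving measurePreserving_one_sub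
  memLp_deriv := (y.memLp_deriv.comp_measurePreserving measurePreserving_one_sub).neg
  rep_eq_val := measurePreserving_one_sub.quasiMeasurePreserving.ae y.rep_eq_val
  rep_eq_integral t ht := by
    have h0 : (0 : ℝ) ∈ Icc (0 : ℝ) 1 := ⟨le_rfl, zero_le_one⟩
    have h1 : (1 : ℝ) ∈ Icc (0 : ℝ) 1 := ⟨zero_le_one, le_rfl⟩
    have ht' : 1 - t ∈ Icc (0 : ℝ) 1 := ⟨by linarith [ht.2], by linarith [ht.1]⟩
    rw [intervalIntegral.integral_neg, intervalIntegral.integral_comp_sub_left, sub_zero,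
      y.rep_eq_integral 1 h1, y.rep_eq_integral (1 - t) ht',
      ← intervalIntegral.integral_add_adjacent_intervals (y.intervalIntegrable_deriv h0 ht')
        (y.intervalIntegrable_deriv ht' h1)]
    abel

theorem continuousOn_norm_sq (y : Trajectory ι) :
    ContinuousOn (fun t => ‖y.rep t‖ ^ 2) (Icc 0 1) := y.continuousOn_rep.norm.pow 2

/-- The equation is tested with `y` itself. Gårding supplies `2 α ‖y‖²`, and Young's inequality with
weight `α` spends half of it on the right-hand side. -/
theorem energy_inequality {b : V →L[ℝ] V →L[ℝ] ℝ} {α ω : ℝ} (hα : 0 < α)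
    (hb : IsGarding ι b α ω) (y : Trajectory ι) {g : ℝ → StrongDual ℝ V} (hg : MemLp g 2 volI)
    (hy : ∀ᵐ t ∂volI, y.deriv t + b (y.val t) = g t) {T : ℝ} (hT : T ∈ Icc (0 : ℝ) 1) :
    ‖y.rep T‖ ^ 2 + α * ∫ t in (0 : ℝ)..T, ‖y.val t‖ ^ 2 ≤
      ‖y.rep 0‖ ^ 2 + α⁻¹ * (∫ t, ‖g t‖ ^ 2 ∂volI) +
        2 * ω * ∫ t in (0 : ℝ)..T, ‖y.rep t‖ ^ 2 := by
  have hibp := y.integral_by_parts y hT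
  rw [real_inner_self_eq_norm_sq, real_inner_self_eq_norm_sq, ← two_mul] at hibp
  have hle : volume.restrict (Ioc 0 T) ≤ volI := by
    rw [volI_eq_restrict_Ioc]
    exact Measure.restrict_mono (Ioc_subset_Ioc_right hT.2) le_rfl
  have i1 : Integrable (fun t => ‖g t‖ ^ 2) (volume.restrict (Ioc 0 T)) :=
    ((memLp_two_iff_integrable_sq_norm hg.1).1 hg).mono_measure hle
  have i2 : Integrable (fun t => ‖y.val t‖ ^ 2) (volume.restrict (Ioc 0 T)) :=
    ((memLp_two_iff_integrable_sq_norm y.memLp_val.1).1 y.memLp_val).mono_measure hle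
  have i3 : Integrable (fun t => ‖y.rep t‖ ^ 2) (volume.restrict (Ioc 0 T)) :=
    ((y.continuousOn_norm_sq.mono (Icc_subset_Icc_right hT.2)).integrableOn_Icc).mono_set
      Ioc_subset_Icc_self
  have i4 : Integrable (fun t => y.deriv t (y.val t)) (volume.restrict (Ioc 0 T)) :=
    (integrable_dual_apply y.memLp_deriv y.memLp_val).mono_measure hle
  have hgN : ∫ t in Ioc 0 T, ‖g t‖ ^ 2 ≤ ∫ t, ‖g t‖ ^ 2 ∂volI :=
    integral_mono_measure hle (Eventually.of_forall fun _ => by positivity)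
      ((memLp_two_iff_integrable_sq_norm hg.1).1 hg)
  have hmain : 2 * ∫ t in Ioc 0 T, y.deriv t (y.val t) ≤
      α⁻¹ * (∫ t in Ioc 0 T, ‖g t‖ ^ 2) - α * (∫ t in Ioc 0 T, ‖y.val t‖ ^ 2) +
        2 * ω * ∫ t in Ioc 0 T, ‖y.rep t‖ ^ 2 := by
    have i5 : Integrable (fun t => α⁻¹ * ‖g t‖ ^ 2 - α * ‖y.val t‖ ^ 2)
        (volume.restrict (Ioc 0 T)) := (i1.const_mul _).sub (i2.const_mul _)
    rw [← integral_const_mul, ← integral_const_mul, ← integral_const_mul, ← integral_const_mul,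
      ← integral_sub (i1.const_mul _) (i2.const_mul _), ← integral_add i5 (i3.const_mul _)]
    refine integral_mono_ae (i4.const_mul _) (i5.add (i3.const_mul _)) ?_
    filter_upwards [ae_mono hle hy, ae_mono hle y.rep_eq_val] with t h1 h2
    have h3 : y.deriv t (y.val t) + b (y.val t) (y.val t) = g t (y.val t) := by
      rw [← h1, add_apply]
    have h4 := hb (y.val t)
    have h5 : g t (y.val t) ≤ ‖g t‖ * ‖y.val t‖ := (le_abs_self _).trans ((g t).le_opNorm _)
    have h6 : 2 * (‖g t‖ * ‖y.val t‖) ≤ α⁻¹ * ‖g t‖ ^ 2 + α * ‖y.val t‖ ^ 2 := by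
      have : α⁻¹ * ‖g t‖ ^ 2 + α * ‖y.val t‖ ^ 2 - 2 * (‖g t‖ * ‖y.val t‖) =
          α⁻¹ * (‖g t‖ - α * ‖y.val t‖) ^ 2 := by field_simp; ring
      have : 0 ≤ α⁻¹ * (‖g t‖ - α * ‖y.val t‖) ^ 2 := by positivity
      linarith
    rw [← h2] at h4
    linarith
  have hgN' := mul_le_mul_of_nonneg_left hgN (inv_nonneg.2 hα.le)
  simp only [intervalIntegral.integral_of_le hT.1] at hibp ⊢
  linarith

/-- Gronwall removes the `ω` term and bounds the `H`-norm; putting this back into the energy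
inequality at time one bounds the `L²(I;V)` norm. The two summands of the constant come from these
two bounds. -/
theorem energy_estimate {b : V →L[ℝ] V →L[ℝ] ℝ} {α ω : ℝ} (hα : 0 < α) (hω : 0 ≤ ω)
    (hb : IsGarding ι b α ω) :
    ∃ C : ℝ, 0 < C ∧ ∀ (y : Trajectory ι) (g : ℝ → StrongDual ℝ V), MemLp g 2 volI →
      (∀ᵐ t ∂volI, y.deriv t + b (y.val t) = g t) →
      (∀ T ∈ Icc (0 : ℝ) 1, ‖y.rep T‖ ^ 2 ≤ C * (‖y.rep 0‖ ^ 2 + ∫ t, ‖g t‖ ^ 2 ∂volI)) ∧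
      ∫ t, ‖y.val t‖ ^ 2 ∂volI ≤ C * (‖y.rep 0‖ ^ 2 + ∫ t, ‖g t‖ ^ 2 ∂volI) := by
  let m := 1 + α⁻¹
  let c := m * Real.exp (2 * ω)
  have hm : 0 < m := by positivity
  have hc : 0 < c := by positivity
  refine ⟨c + α⁻¹ * (m + 2 * ω * c), by positivity, fun y g hg hy => ?_⟩
  set N := ‖y.rep 0‖ ^ 2 + ∫ t, ‖g t‖ ^ 2 ∂volI with hN
  have hg0 : 0 ≤ ∫ t, ‖g t‖ ^ 2 ∂volI := integral_nonneg fun _ => by positivity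
  have hN0 : 0 ≤ N := by positivity
  have hmN : ‖y.rep 0‖ ^ 2 + α⁻¹ * (∫ t, ‖g t‖ ^ 2 ∂volI) ≤ m * N := by
    have : m * N - (‖y.rep 0‖ ^ 2 + α⁻¹ * (∫ t, ‖g t‖ ^ 2 ∂volI)) =
      α⁻¹ * ‖y.rep 0‖ ^ 2 + ∫ t, ‖g t‖ ^ 2 ∂volI := by simp only [m, hN]; ring
    have : 0 ≤ α⁻¹ * ‖y.rep 0‖ ^ 2 := by positivity
    linarith
  have hen := fun T hT => y.energy_inequality hα hb hg hy (T := T) hT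
  have hval0 : ∀ T ∈ Icc (0 : ℝ) 1, 0 ≤ α * ∫ t in (0 : ℝ)..T, ‖y.val t‖ ^ 2 := fun T hT =>
    mul_nonneg hα.le (intervalIntegral.integral_nonneg hT.1 fun _ _ => by positivity)
  have hgr := le_mul_exp_of_le_integral (K := m * N) (c := 2 * ω) y.continuousOn_norm_sq
    (fun _ _ => by positivity) (by positivity) fun T hT => by
      linarith [hen T hT, hval0 T hT]
  have hsup : ∀ T ∈ Icc (0 : ℝ) 1, ‖y.rep T‖ ^ 2 ≤ c * N := fun T hT => by
    refine (hgr T hT).trans ?_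
    have : Real.exp (2 * ω * T) ≤ Real.exp (2 * ω) :=
      Real.exp_le_exp.2 (mul_le_of_le_one_right (by positivity) hT.2)
    calc m * N * Real.exp (2 * ω * T) ≤ m * N * Real.exp (2 * ω) := by gcongr
      _ = c * N := by simp only [c]; ring
  refine ⟨fun T hT => (hsup T hT).trans ?_, ?_⟩
  · have : 0 ≤ α⁻¹ * (m + 2 * ω * c) * N := by positivity
    nlinarith
  · have h1 : (1 : ℝ) ∈ Icc (0 : ℝ) 1 := ⟨zero_le_one, le_rfl⟩
    have h2 := hen 1 h1
    have h3 : ∫ t in (0 : ℝ)..1, ‖y.rep t‖ ^ 2 ≤ c * N := by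
      have := intervalIntegral.integral_mono_on (μ := volume) (zero_le_one (α := ℝ))
        (y.continuousOn_norm_sq.intervalIntegrable_of_Icc zero_le_one)
        (intervalIntegrable_const (c := c * N)) hsup
      simpa using this
    rw [← setIntegral_Ioo_eq_intervalIntegral (fun t => ‖y.val t‖ ^ 2)] at h2
    have h4 : α * ∫ t in Ioo (0 : ℝ) 1, ‖y.val t‖ ^ 2 ≤ (m + 2 * ω * c) * N := by
      have h5 := mul_le_mul_of_nonneg_left h3 (show 0 ≤ 2 * ω by positivity)
      nlinarith [sq_nonneg ‖y.rep 1‖]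
    have h6 : ∫ t in Ioo (0 : ℝ) 1, ‖y.val t‖ ^ 2 ≤ α⁻¹ * ((m + 2 * ω * c) * N) := by
      rw [le_inv_mul_iff₀ hα]; exact h4
    have h7 : 0 ≤ c * N := by positivity
    calc _ ≤ α⁻¹ * ((m + 2 * ω * c) * N) := h6
      _ ≤ _ := by nlinarith

end Trajectory

end Energy

/-! ### Solvable data of the evolution equation -/

section Evolution

open Filter Topology

variable {V H : Type*}
  [NormedAddCommGroup V] [InnerProductSpace ℝ V] [CompleteSpace V]
  [NormedAddCommGroup H] [InnerProductSpace ℝ H] [CompleteSpace H]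

namespace Trajectory

variable {ι : V →L[ℝ] H}

/-- The trajectory as an element of `L²(I;V)`. -/
def valLp (y : Trajectory ι) : Lp V 2 volI := y.memLp_val.toLp y.val

/-- `y` solves `∂ₜ y + b y = g` with `g` the functional represented by `γ ∈ L²(I;V)`. -/
def Solves (b : V →L[ℝ] V →L[ℝ] ℝ) (γ : Lp V 2 volI) (y : Trajectory ι) : Prop :=
  ∀ᵐ t ∂volI, y.deriv t + b (y.val t) = InnerProductSpace.toDual ℝ V (γ t)

theorem Solves.comb {b : V →L[ℝ] V →L[ℝ] ℝ} {γ γ' : Lp V 2 volI} {y z : Trajectory ι}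
    (hy : y.Solves b γ) (hz : z.Solves b γ') (c d : ℝ) :
    (y.comb c d z).Solves b (c • γ + d • γ') := by
  filter_upwards [hy, hz, Lp.coeFn_add (c • γ) (d • γ'), Lp.coeFn_smul c γ, Lp.coeFn_smul d γ']
    with t h1 h2 h3 h4 h5
  rw [h3, Pi.add_apply, h4, h5, Pi.smul_apply, Pi.smul_apply, map_add, LinearIsometryEquiv.map_smul,
    LinearIsometryEquiv.map_smul, ← h1, ← h2]
  simp only [Trajectory.comb, map_add, map_smul]
  module

theorem valLp_comb (c d : ℝ) (y z : Trajectory ι) :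
    (y.comb c d z).valLp = c • y.valLp + d • z.valLp := by
  rw [valLp, valLp, valLp, ← MemLp.toLp_const_smul, ← MemLp.toLp_const_smul, ← MemLp.toLp_add]
  rfl

theorem norm_estimate {b : V →L[ℝ] V →L[ℝ] ℝ} {α ω : ℝ} (hα : 0 < α) (hω : 0 ≤ ω)
    (hb : IsGarding ι b α ω) :
    ∃ C : ℝ, 0 < C ∧ ∀ (y : Trajectory ι) (γ : Lp V 2 volI), y.Solves b γ →
      (∀ T ∈ Icc (0 : ℝ) 1, ‖y.rep T‖ ≤ C * (‖y.rep 0‖ + ‖γ‖)) ∧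
      ‖y.valLp‖ ≤ C * (‖y.rep 0‖ + ‖γ‖) := by
  obtain ⟨C, hC, h⟩ := energy_estimate hα hω hb
  have key : ∀ x a c : ℝ, 0 ≤ x → 0 ≤ a → 0 ≤ c → x ^ 2 ≤ C * (a ^ 2 + c ^ 2) →
      x ≤ √C * (a + c) := by
    intro x a c hx ha hc h
    refine abs_le_of_sq_le_sq' ?_ (by positivity) |>.2
    rw [mul_pow, Real.sq_sqrt hC.le]
    refine h.trans (mul_le_mul_of_nonneg_left ?_ hC.le)
    nlinarith [mul_nonneg ha hc]
  refine ⟨√C, Real.sqrt_pos.2 hC, fun y γ hy => ?_⟩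
  have h1 := h y (fun t => InnerProductSpace.toDual ℝ V (γ t)) (memLp_toDual (Lp.memLp γ)) hy
  simp only [LinearIsometryEquiv.norm_map, ← norm_sq_Lp] at h1
  refine ⟨fun T hT => key _ _ _ (norm_nonneg _) (norm_nonneg _) (norm_nonneg _) (h1.1 T hT),
    key _ _ _ (norm_nonneg _) (norm_nonneg _) (norm_nonneg _) ?_⟩
  rw [valLp, norm_sq_toLp]
  exact h1.2

/-- The initial values and right-hand sides for which the evolution equation is solvable. -/
def solvableData (ι : V →L[ℝ] H) (b : V →L[ℝ] V →L[ℝ] ℝ) :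
    Submodule ℝ (WithLp 2 (H × Lp V 2 volI)) where
  carrier := {x | ∃ y : Trajectory ι, y.Solves b x.snd ∧ y.rep 0 = x.fst}
  add_mem' := by
    rintro x x' ⟨y, hy, hy0⟩ ⟨z, hz, hz0⟩
    refine ⟨y.comb 1 1 z, ?_, ?_⟩
    · have := hy.comb hz 1 1
      rwa [one_smul, one_smul] at this
    · simp [Trajectory.comb, hy0, hz0]
  zero_mem' := by
    refine ⟨(Classical.arbitrary (Trajectory ι)).comb 0 0 (Classical.arbitrary _), ?_, ?_⟩
    · have h0 : (0 : WithLp 2 (H × Lp V 2 volI)).snd = 0 := rfl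
      rw [h0]
      filter_upwards [Lp.coeFn_zero V 2 volI] with t ht
      rw [ht]
      simp [Trajectory.comb]
    · simp [Trajectory.comb]
  smul_mem' := by
    rintro c x ⟨y, hy, hy0⟩
    refine ⟨y.comb c 0 y, ?_, ?_⟩
    · have := hy.comb hy c 0
      rwa [zero_smul, add_zero] at this
    · simp [Trajectory.comb, hy0]

theorem restrict_Ioc_volI {t : ℝ} (ht : t ∈ Icc (0 : ℝ) 1) :
    volI.restrict (Ioc 0 t) = volume.restrict (Ioc 0 t) := by
  rw [volI_eq_restrict_Ioc, Measure.restrict_restrict_of_subset (Ioc_subset_Ioc_right ht.2)]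

/-- Tested with a fixed `w`, the integrated equation consists of inner products with fixed elements
of `L²(I;V)`, so it passes to limits in `γ` and `v`. -/
theorem integral_toDual_sub_apply (b : V →L[ℝ] V →L[ℝ] ℝ) (γ v : Lp V 2 volI) {t : ℝ}
    (ht : t ∈ Icc (0 : ℝ) 1) (w : V) :
    (∫ s in (0 : ℝ)..t, (InnerProductSpace.toDual ℝ V (γ s) - b (v s))) w =
      inner ℝ (indicatorConstLp 2 (measurableSet_Ioc (a := (0 : ℝ)) (b := t))
        (measure_ne_top volI _) w) γ -
      inner ℝ (indicatorConstLp 2 (measurableSet_Ioc (a := (0 : ℝ)) (b := t))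
        (measure_ne_top volI _) (riesz V (b.flip w))) v := by
  have i1 : Integrable (fun s => InnerProductSpace.toDual ℝ V (γ s)) (volI.restrict (Ioc 0 t)) :=
    ((memLp_toDual (Lp.memLp γ)).integrable (by norm_num)).restrict
  have i2 : Integrable (fun s => b (v s)) (volI.restrict (Ioc 0 t)) :=
    ((b.comp_memLp' (Lp.memLp v)).integrable (by norm_num)).restrict
  rw [L2.inner_indicatorConstLp_eq_setIntegral_inner, L2.inner_indicatorConstLp_eq_setIntegral_inner,
    intervalIntegral.integral_of_le ht.1, ← restrict_Ioc_volI ht,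
    integral_sub i1 i2, sub_apply, ContinuousLinearMap.integral_apply i1,
    ContinuousLinearMap.integral_apply i2]
  congr 1
  · refine integral_congr_ae (Eventually.of_forall fun s => ?_)
    simp only [InnerProductSpace.toDual_apply_apply, real_inner_comm w]
  · refine integral_congr_ae (Eventually.of_forall fun s => ?_)
    simp only [inner_riesz, ContinuousLinearMap.flip_apply]

theorem Solves.rep_eq {b : V →L[ℝ] V →L[ℝ] ℝ} {γ : Lp V 2 volI} {y : Trajectory ι}
    (hy : y.Solves b γ) {t : ℝ} (ht : t ∈ Icc (0 : ℝ) 1) :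
    (innerSL ℝ (y.rep t)).comp ι = (innerSL ℝ (y.rep 0)).comp ι +
      ∫ s in (0 : ℝ)..t, (InnerProductSpace.toDual ℝ V (γ s) - b (y.valLp s)) := by
  rw [y.rep_eq_integral t ht]
  congr 1
  rw [intervalIntegral.integral_of_le ht.1, intervalIntegral.integral_of_le ht.1,
    ← restrict_Ioc_volI ht]
  refine integral_congr_ae (ae_restrict_of_ae ?_)
  filter_upwards [hy, y.memLp_val.coeFn_toLp] with s h1 h2
  rw [← h1, valLp, h2]
  abel

theorem cauchySeq_of_dist_le {X Y : Type*} [PseudoMetricSpace X] [PseudoMetricSpace Y]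
    {x : ℕ → X} (hx : CauchySeq x) {f : ℕ → Y} {C : ℝ}
    (hf : ∀ n m, dist (f n) (f m) ≤ C * dist (x n) (x m)) : CauchySeq f := by
  rw [Metric.cauchySeq_iff] at hx ⊢
  intro ε hε
  obtain ⟨N, hN⟩ := hx (ε / (|C| + 1)) (by positivity)
  refine ⟨N, fun m hm n hn => (hf m n).trans_lt ?_⟩
  have h1 := hN m hm n hn
  rw [lt_div_iff₀ (by positivity)] at h1
  nlinarith [le_abs_self C, dist_nonneg (x := x m) (y := x n)]

/-- By the energy estimate for differences, convergent data have solutions that are Cauchy both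
uniformly in `H` and in `L²(I;V)`. -/
theorem isClosed_solvableData {b : V →L[ℝ] V →L[ℝ] ℝ} {α ω : ℝ} (hα : 0 < α) (hω : 0 ≤ ω)
    (hb : IsGarding ι b α ω) :
    IsClosed (solvableData ι b : Set (WithLp 2 (H × Lp V 2 volI))) := by
  obtain ⟨C, hC, hest⟩ := norm_estimate hα hω hb
  refine IsSeqClosed.isClosed fun x p hx hp => ?_
  choose y hy hy0 using hx
  have hdiff : ∀ n m, (∀ T ∈ Icc (0 : ℝ) 1, dist ((y n).rep T) ((y m).rep T) ≤
      2 * C * dist (x n) (x m)) ∧ dist (y n).valLp (y m).valLp ≤ 2 * C * dist (x n) (x m) := by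
    intro n m
    have h1 := hest _ _ ((hy n).comb (hy m) 1 (-1))
    have h2 : ∀ T, ((y n).comb 1 (-1) (y m)).rep T = (y n).rep T - (y m).rep T := fun T => by
      simp [Trajectory.comb, sub_eq_add_neg]
    have h3 : C * (‖((y n).comb 1 (-1) (y m)).rep 0‖ + ‖(1 : ℝ) • (x n).snd + (-1 : ℝ) • (x m).snd‖)
        ≤ 2 * C * dist (x n) (x m) := by
      rw [h2, hy0, hy0, one_smul, neg_one_smul, ← sub_eq_add_neg, dist_eq_norm]
      have h4 : ‖(x n).fst - (x m).fst‖ ≤ ‖x n - x m‖ := WithLp.norm_fst_le (p := 2) H (x n - x m)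
      have h5 : ‖(x n).snd - (x m).snd‖ ≤ ‖x n - x m‖ := WithLp.norm_snd_le (p := 2) H (x n - x m)
      nlinarith
    refine ⟨fun T hT => ?_, ?_⟩
    · rw [dist_eq_norm, ← h2]
      exact (h1.1 T hT).trans h3
    · rw [dist_eq_norm]
      have h4 := h1.2
      rw [valLp_comb, one_smul, neg_one_smul, ← sub_eq_add_neg] at h4
      exact h4.trans h3
  have hcauchy := hp.cauchySeq
  obtain ⟨v, hv⟩ := cauchySeq_tendsto_of_complete (cauchySeq_of_dist_le hcauchy fun n m => (hdiff n m).2)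
  have hrep : ∀ T : ℝ, ∃ r : H, T ∈ Icc (0 : ℝ) 1 → Tendsto (fun n => (y n).rep T) atTop (𝓝 r) := by
    intro T
    by_cases hT : T ∈ Icc (0 : ℝ) 1
    · obtain ⟨r, hr⟩ := cauchySeq_tendsto_of_complete (cauchySeq_of_dist_le hcauchy fun n m => (hdiff n m).1 T hT)
      exact ⟨r, fun _ => hr⟩
    · exact ⟨0, fun h => absurd h hT⟩
  choose ρ hρ using hrep
  have hunif : TendstoUniformlyOn (fun n => (y n).rep) ρ atTop (Icc 0 1) := by
    rw [Metric.tendstoUniformlyOn_iff]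
    intro ε hε
    have h1 : Tendsto (fun n => 2 * C * dist (x n) p) atTop (𝓝 0) := by
      have := (hp.dist (tendsto_const_nhds (x := p))).const_mul (2 * C)
      rwa [dist_self, mul_zero] at this
    filter_upwards [h1.eventually (gt_mem_nhds hε)] with n hn T hT
    rw [dist_comm]
    refine lt_of_le_of_lt ?_ hn
    exact le_of_tendsto_of_tendsto (tendsto_const_nhds.dist (hρ T hT))
      ((tendsto_const_nhds.dist hp).const_mul (2 * C)) (Eventually.of_forall fun m => (hdiff n m).1 T hT)
  have h0 : (0 : ℝ) ∈ Icc (0 : ℝ) 1 := ⟨le_rfl, zero_le_one⟩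
  have hfst : Tendsto (fun n => (x n).fst) atTop (𝓝 p.fst) :=
    ((WithLp.prod_continuous_ofLp 2 H (Lp V 2 volI)).fst.tendsto p).comp hp
  have hsnd : Tendsto (fun n => (x n).snd) atTop (𝓝 p.snd) :=
    ((WithLp.prod_continuous_ofLp 2 H (Lp V 2 volI)).snd.tendsto p).comp hp
  -- The derivative is defined by the equation itself, so what remains is to match the uniform limit
  -- with the `L²` limit, along an a.e. convergent subsequence, and to pass to the limit in the
  -- integrated equation.
  let z : Trajectory ι :=
    { rep := ρ
      val := v
      deriv := fun t => InnerProductSpace.toDual ℝ V (p.snd t) - b (v t)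
      continuousOn_rep := hunif.continuousOn (Frequently.of_forall fun n => (y n).continuousOn_rep)
      memLp_val := Lp.memLp v
      memLp_deriv := (memLp_toDual (Lp.memLp p.snd)).sub (b.comp_memLp' (Lp.memLp v))
      rep_eq_val := by
        obtain ⟨ns, hns, hae⟩ := (tendstoInMeasure_of_tendsto_Lp hv).exists_seq_tendsto_ae
        have h1 : ∀ᵐ t ∂volI, ∀ n, (y n).rep t = ι ((y n).valLp t) := by
          rw [ae_all_iff]
          intro n
          filter_upwards [(y n).rep_eq_val, (y n).memLp_val.coeFn_toLp] with t h2 h3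
          rw [h2, valLp, h3]
        filter_upwards [hae, h1, ae_restrict_mem measurableSet_Ioo] with t h2 h3 h4
        refine tendsto_nhds_unique ((hρ t (Ioo_subset_Icc_self h4)).comp hns.tendsto_atTop) ?_
        simp only [Function.comp_def, h3]
        exact (ι.continuous.tendsto _).comp h2
      rep_eq_integral := by
        intro t ht
        ext w
        rw [add_apply, integral_toDual_sub_apply b p.snd v ht w]
        have h1 : Tendsto (fun n => inner ℝ ((y n).rep t) (ι w)) atTop (𝓝 (inner ℝ (ρ t) (ι w))) :=
          (hρ t ht).inner tendsto_const_nhds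
        have h2 : Tendsto (fun n => inner ℝ ((y n).rep 0) (ι w)) atTop (𝓝 (inner ℝ (ρ 0) (ι w))) :=
          (hρ 0 h0).inner tendsto_const_nhds
        refine tendsto_nhds_unique h1 ((h2.add ((tendsto_const_nhds.inner hsnd).sub
          (tendsto_const_nhds.inner hv))).congr fun n => ?_)
        have h3 := congrArg (fun φ : StrongDual ℝ V => φ w) ((hy n).rep_eq ht)
        simp only [add_apply, integral_toDual_sub_apply b _ _ ht w] at h3
        exact h3.symm }
  refine ⟨z, Eventually.of_forall fun t => sub_add_cancel _ _, ?_⟩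
  refine tendsto_nhds_unique (hρ 0 h0) ?_
  simpa only [hy0] using hfst

end Trajectory

end Evolution

/-! ### Existence for the evolution equation -/

section Existence

open Filter Topology

variable {V H : Type*}
  [NormedAddCommGroup V] [InnerProductSpace ℝ V] [CompleteSpace V]
  [NormedAddCommGroup H] [InnerProductSpace ℝ H] [CompleteSpace H]

namespace Trajectory

variable {ι : V →L[ℝ] H}

theorem memLp_volI_of_continuous {E : Type*} [NormedAddCommGroup E] {f : ℝ → E}
    (hf : Continuous f) : MemLp f 2 volI := by
  obtain ⟨C, hC⟩ := isCompact_Icc.exists_bound_of_continuousOn (hf.continuousOn (s := Icc 0 1))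
  refine MemLp.of_bound hf.aestronglyMeasurable C ?_
  filter_upwards [ae_restrict_mem measurableSet_Ioo] with t ht
  exact hC t (Ioo_subset_Icc_self ht)

/-- The map `V → V*`, `v ↦ (ι v, ι ·)`, given by the Gelfand triple. -/
def gelfand (ι : V →L[ℝ] H) : V →L[ℝ] StrongDual ℝ V :=
  ((ContinuousLinearMap.compL ℝ V H ℝ).flip ι).comp ((innerSL ℝ).comp ι)

theorem gelfand_apply (v : V) : gelfand ι v = (innerSL ℝ (ι v)).comp ι := rfl

/-- The trajectory `t ↦ v + ∫₀ᵗ ψ`. -/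
def ofPrimitive (ι : V →L[ℝ] H) (v : V) {ψ : ℝ → V} (hψ : MemLp ψ 2 volume) : Trajectory ι :=
  have hcont : Continuous fun t => v + ∫ s in (0 : ℝ)..t, ψ s :=
    continuous_const.add
      (intervalIntegral.continuous_primitive (intervalIntegrable_of_memLp hψ) 0)
  { rep := fun t => ι (v + ∫ s in (0 : ℝ)..t, ψ s)
    val := fun t => v + ∫ s in (0 : ℝ)..t, ψ s
    deriv := fun t => gelfand ι (ψ t)
    continuousOn_rep := (ι.continuous.comp hcont).continuousOn
    memLp_val := memLp_volI_of_continuous hcont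
    memLp_deriv := (gelfand ι).comp_memLp' (hψ.restrict _)
    rep_eq_val := Eventually.of_forall fun _ => rfl
    rep_eq_integral := fun t _ => by
      rw [(gelfand ι).intervalIntegral_comp_comm (intervalIntegrable_of_memLp hψ 0 t),
        intervalIntegral.integral_same, add_zero, ← gelfand_apply, ← gelfand_apply, map_add] }

/-- Every trajectory solves the equation for its own data, so orthogonality may be tested with
arbitrary trajectories. -/
theorem inner_eq_zero_of_mem_orthogonal {b : V →L[ℝ] V →L[ℝ] ℝ}
    {x : WithLp 2 (H × Lp V 2 volI)} (hx : x ∈ (solvableData ι b)ᗮ) (y : Trajectory ι) :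
    inner ℝ (y.rep 0) x.fst + ∫ t, (y.deriv t + b (y.val t)) (x.snd t) ∂volI = 0 := by
  have hs : MemLp (fun t => y.deriv t + b (y.val t)) 2 volI := by
    have hv : MemLp (fun t => (b (y.val t) : StrongDual ℝ V)) 2 volI := b.comp_memLp' y.memLp_val
    exact MemLp.add (f := y.deriv) (g := fun t => (b (y.val t) : StrongDual ℝ V)) y.memLp_deriv hv
  have hg : MemLp (fun t => riesz V (y.deriv t + b (y.val t))) 2 volI := memLp_riesz hs
  have hae := hg.coeFn_toLp
  generalize hg.toLp _ = γ at hae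
  have hmem : WithLp.toLp 2 (y.rep 0, γ) ∈ solvableData ι b := by
    refine ⟨y, ?_, rfl⟩
    filter_upwards [hae] with t ht
    change _ = InnerProductSpace.toDual ℝ V (γ t)
    rw [ht]
    exact ((InnerProductSpace.toDual ℝ V).apply_symm_apply _).symm
  have h1 := (Submodule.mem_orthogonal _ _).1 hx _ hmem
  rw [WithLp.prod_inner_apply] at h1
  refine Eq.trans ?_ h1
  change _ = inner ℝ (y.rep 0) x.fst + inner ℝ γ x.snd
  rw [L2.inner_def]
  congr 1
  refine integral_congr_ae ?_
  filter_upwards [hae] with t ht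
  rw [ht, inner_riesz]

theorem memLp_exp_smul_indicator {φ : ℝ → V} (hφ : MemLp φ 2 volI) {c : ℝ} (hc : 0 ≤ c) :
    MemLp (fun t => Real.exp (c * t) • (Ioc 0 1).indicator φ t) 2 volume := by
  have h1 := memLp_indicator_Ioc le_rfl hφ
  refine h1.of_le_mul (c := Real.exp c)
    (AEStronglyMeasurable.smul (by fun_prop) h1.1) (Eventually.of_forall fun t => ?_)
  rw [norm_smul, Real.norm_of_nonneg (Real.exp_pos _).le]
  by_cases ht : t ∈ Ioc (0 : ℝ) 1
  · gcongr
    nlinarith [ht.2]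
  · rw [indicator_of_notMem ht]
    simp

/-- The limit of the accretivity factor is exactly the Gårding shift: the weight `exp (2 ω t)` is
chosen for this. -/
theorem tendsto_one_sub_exp (ω : ℝ) :
    Tendsto (fun h : ℝ => (1 - Real.exp (2 * ω * -h)) / (2 * h)) (𝓝[>] 0) (𝓝 ω) := by
  have hd : HasDerivAt (fun h : ℝ => Real.exp (2 * ω * h)) (2 * ω) 0 := by
    have := ((hasDerivAt_id (0 : ℝ)).const_mul (2 * ω)).exp
    simpa using this
  have h1 := ((hasDerivAt_iff_tendsto_slope_zero.1 hd).comp tendsto_neg_nhdsGT).const_mul (1 / 2)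
  simp only [zero_add, mul_zero, Real.exp_zero, smul_eq_mul] at h1
  have h2 : 1 / 2 * (2 * ω) = ω := by ring
  rw [h2] at h1
  refine h1.congr' ?_
  filter_upwards [self_mem_nhdsWithin] with h hh
  have : h ≠ 0 := ne_of_gt hh
  simp only [Function.comp_apply]
  field_simp
  ring

/-- Backward difference quotients are almost accretive for exponential weights. -/
theorem integral_inner_backward_difference_ge {φ : ℝ → V} (hφ : MemLp φ 2 volI) {ω : ℝ}
    (hω : 0 ≤ ω) {h : ℝ} (hh : 0 < h) :
    (1 - Real.exp (2 * ω * -h)) / (2 * h) *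
        ∫ t, Real.exp (2 * ω * t) * ‖ι ((Ioc 0 1).indicator φ t)‖ ^ 2 ≤
      ∫ t, inner ℝ (ι (h⁻¹ • (Real.exp (2 * ω * t) • (Ioc 0 1).indicator φ t -
        Real.exp (2 * ω * (t - h)) • (Ioc 0 1).indicator φ (t - h))))
          (ι ((Ioc 0 1).indicator φ t)) := by
  set Φ := (Ioc (0 : ℝ) 1).indicator φ with hΦdef
  have hΦ : MemLp Φ 2 volume := memLp_indicator_Ioc le_rfl hφ
  have hM : MemLp (fun t => Real.exp (2 * ω * t) • Φ t) 2 volume :=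
    memLp_exp_smul_indicator hφ (by positivity)
  have hMh : MemLp (fun t => Real.exp (2 * ω * (t - h)) • Φ (t - h)) 2 volume :=
    memLp_comp_add_right hM (-h)
  have hιΦ : MemLp (fun t => ι (Φ t)) 2 volume := ι.comp_memLp' hΦ
  have i1 : Integrable (fun t => Real.exp (2 * ω * t) * ‖ι (Φ t)‖ ^ 2) volume := by
    refine (integrable_inner_of_memLp (ι.comp_memLp' hM) hιΦ).congr (Eventually.of_forall fun t => ?_)
    simp only [Function.comp_apply, map_smul, inner_smul_left, real_inner_self_eq_norm_sq,
      RCLike.conj_to_real]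
  have i2 : Integrable (fun t => inner ℝ (ι (Real.exp (2 * ω * (t - h)) • Φ (t - h))) (ι (Φ t)))
      volume := integrable_inner_of_memLp (ι.comp_memLp' hMh) hιΦ
  have i3 := i1.comp_sub_right h
  set D := ∫ t, Real.exp (2 * ω * t) * ‖ι (Φ t)‖ ^ 2 with hD
  have e1 : ∫ t, Real.exp (2 * ω * (t - h)) * ‖ι (Φ (t - h))‖ ^ 2 = D :=
    integral_sub_right_eq_self (fun t => Real.exp (2 * ω * t) * ‖ι (Φ t)‖ ^ 2) h
  -- Young's inequality on the cross term: the shifted half integrates to `D / 2` by translation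
  -- invariance, the unshifted one gains the factor `exp (-2 ω h)`.
  have h1 : ∫ t, inner ℝ (ι (Real.exp (2 * ω * (t - h)) • Φ (t - h))) (ι (Φ t)) ≤
      1 / 2 * D + 1 / 2 * Real.exp (2 * ω * -h) * D := by
    have e2 : 1 / 2 * D + 1 / 2 * Real.exp (2 * ω * -h) * D =
        ∫ t, (1 / 2 * (Real.exp (2 * ω * (t - h)) * ‖ι (Φ (t - h))‖ ^ 2) +
          1 / 2 * Real.exp (2 * ω * -h) * (Real.exp (2 * ω * t) * ‖ι (Φ t)‖ ^ 2)) := by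
      rw [integral_add (i3.const_mul _) (i1.const_mul _), integral_const_mul, integral_const_mul, e1]
    rw [e2]
    refine integral_mono i2 ((i3.const_mul _).add (i1.const_mul _)) fun t => ?_
    have h2 : Real.exp (2 * ω * (t - h)) = Real.exp (2 * ω * -h) * Real.exp (2 * ω * t) := by
      rw [← Real.exp_add]; ring_nf
    have h3 := real_inner_le_norm (ι (Φ (t - h))) (ι (Φ t))
    have h4 : inner ℝ (ι (Φ (t - h))) (ι (Φ t)) ≤
        1 / 2 * ‖ι (Φ (t - h))‖ ^ 2 + 1 / 2 * ‖ι (Φ t)‖ ^ 2 := by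
      nlinarith [sq_nonneg (‖ι (Φ (t - h))‖ - ‖ι (Φ t)‖)]
    have h5 := mul_le_mul_of_nonneg_left h4 (Real.exp_pos (2 * ω * (t - h))).le
    simp only [map_smul, inner_smul_left, RCLike.conj_to_real]
    refine h5.trans (le_of_eq ?_)
    rw [h2]
    ring
  have h6 : ∫ t, inner ℝ (ι (h⁻¹ • (Real.exp (2 * ω * t) • Φ t -
      Real.exp (2 * ω * (t - h)) • Φ (t - h)))) (ι (Φ t)) =
      h⁻¹ * (D - ∫ t, inner ℝ (ι (Real.exp (2 * ω * (t - h)) • Φ (t - h))) (ι (Φ t))) := by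
    rw [hD, ← integral_sub i1 i2, ← integral_const_mul]
    refine integral_congr_ae (Eventually.of_forall fun t => ?_)
    simp only [map_smul, map_sub, inner_smul_left, inner_sub_left, real_inner_self_eq_norm_sq,
      RCLike.conj_to_real]
  rw [h6]
  have h7 : (1 - Real.exp (2 * ω * -h)) / (2 * h) * D =
      h⁻¹ * (D - (1 / 2 * D + 1 / 2 * Real.exp (2 * ω * -h) * D)) := by
    field_simp
    ring
  rw [h7]
  gcongr

/-- Formally one tests with `exp (2 ω t) φ`: its derivative contributes at least `ω` times the
weighted `H`-norm squared of `φ`, which compensates the shift in Gårding's inequality and forces `φ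
= 0`. Since `φ` need not be differentiable, the test function is a backward average instead. -/
theorem orthogonal_solvableData {b : V →L[ℝ] V →L[ℝ] ℝ} {α ω : ℝ} (hα : 0 < α) (hω : 0 ≤ ω)
    (hb : IsGarding ι b α ω) (hι : DenseRange ι) : (solvableData ι b)ᗮ = ⊥ := by
  rw [Submodule.eq_bot_iff]
  intro x hx
  have hort := inner_eq_zero_of_mem_orthogonal hx
  set φ : ℝ → V := fun t => x.snd t
  have hφ : MemLp φ 2 volI := Lp.memLp x.snd
  set Φ := (Ioc (0 : ℝ) 1).indicator φ with hΦdef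
  have hΦ : MemLp Φ 2 volume := memLp_indicator_Ioc le_rfl hφ
  set M : ℝ → V := fun t => Real.exp (2 * ω * t) • Φ t with hMdef
  have hM : MemLp M 2 volume := memLp_exp_smul_indicator hφ (by positivity)
  have hMint := intervalIntegrable_of_memLp hM
  let b' : V →L[ℝ] V := (riesz V).toContinuousLinearEquiv.toContinuousLinearMap.comp b.flip
  have hb' : ∀ v w, inner ℝ v (b' w) = b v w := fun v w => by
    rw [real_inner_comm]; exact inner_riesz _ _
  have hW : MemLp (fun t => b' (Φ t)) 2 volume := b'.comp_memLp' hΦ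
  set D := ∫ t, Real.exp (2 * ω * t) * ‖ι (Φ t)‖ ^ 2 with hD
  have hlim := (tendsto_integral_inner_steklov hM hW).comp tendsto_neg_nhdsGT
  -- The test trajectory is the mean of `M` over `[t - h, t]`. It vanishes at time zero because `M`
  -- does on the nonpositive axis, and its derivative is the backward difference quotient of `M`.
  have key : ∀ h : ℝ, 0 < h → (1 - Real.exp (2 * ω * -h)) / (2 * h) * D +
      (-h)⁻¹ * ∫ r, inner ℝ (∫ s in r..r + -h, M s) (b' (Φ r)) ≤ 0 := by
    intro h hh
    have hMh : MemLp (fun t => M (t - h)) 2 volume := memLp_comp_add_right hM (-h)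
    have hψ : MemLp (fun t => h⁻¹ • (M t - M (t - h))) 2 volume := (hM.sub hMh).const_smul h⁻¹
    have hprim : ∀ t, ∫ s in (0 : ℝ)..t, h⁻¹ • (M s - M (s - h)) =
        (-h)⁻¹ • ∫ s in t..t + -h, M s := by
      intro t
      rw [intervalIntegral.integral_smul, intervalIntegral.integral_sub (hMint _ _)
        (intervalIntegrable_of_memLp hMh _ _), intervalIntegral.integral_comp_sub_right, zero_sub,
        inv_neg, neg_smul, ← smul_neg, ← intervalIntegral.integral_symm, ← sub_eq_add_neg]
      congr 1
      have h0 : ∫ s in (-h)..0, M s = 0 := by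
        rw [intervalIntegral.integral_of_le (by linarith)]
        refine setIntegral_eq_zero_of_forall_eq_zero fun s hs => ?_
        have : s ∉ Ioc (0 : ℝ) 1 := fun h' => absurd h'.1 (not_lt.2 hs.2)
        simp only [hMdef, hΦdef, indicator_of_notMem this, smul_zero]
      rw [← intervalIntegral.integral_add_adjacent_intervals (hMint (-h) 0) (hMint 0 (t - h)), h0,
        zero_add, intervalIntegral.integral_interval_sub_left (hMint _ _) (hMint _ _)]
    have h1 := hort (ofPrimitive ι 0 hψ)
    have hrep0 : (ofPrimitive ι 0 hψ).rep 0 = 0 := by simp [ofPrimitive]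
    rw [hrep0, inner_zero_left, zero_add] at h1
    have h2 : ∫ t, ((ofPrimitive ι 0 hψ).deriv t + b ((ofPrimitive ι 0 hψ).val t)) (φ t) ∂volI =
        ∫ t, (inner ℝ (ι (h⁻¹ • (M t - M (t - h)))) (ι (Φ t)) +
          (-h)⁻¹ * inner ℝ (∫ s in t..t + -h, M s) (b' (Φ t))) := by
      rw [volI_eq_restrict_Ioc, ← integral_indicator measurableSet_Ioc]
      congr 1
      ext t
      by_cases ht : t ∈ Ioc (0 : ℝ) 1
      · rw [indicator_of_mem ht]
        simp only [ofPrimitive, zero_add, hprim, hΦdef, indicator_of_mem ht, hb', add_apply,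
          gelfand_apply, ContinuousLinearMap.comp_apply, innerSL_apply_apply, map_smul, smul_apply,
          smul_eq_mul, real_inner_smul_left]
      · rw [indicator_of_notMem ht]
        simp only [hΦdef, indicator_of_notMem ht, map_zero, inner_zero_right, mul_zero, add_zero]
    have i1 : Integrable (fun t => inner ℝ (ι (h⁻¹ • (M t - M (t - h)))) (ι (Φ t))) volume :=
      integrable_inner_of_memLp (ι.comp_memLp' hψ) (ι.comp_memLp' hΦ)
    have i2 : Integrable (fun t => (-h)⁻¹ * inner ℝ (∫ s in t..t + -h, M s) (b' (Φ t))) volume := by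
      have hv : MemLp ((Ioc (0 : ℝ) 1).indicator (ofPrimitive ι 0 hψ).val) 2 volume :=
        memLp_indicator_Ioc le_rfl (ofPrimitive ι 0 hψ).memLp_val
      refine (integrable_inner_of_memLp hv hW).congr (Eventually.of_forall fun t => ?_)
      by_cases ht : t ∈ Ioc (0 : ℝ) 1
      · simp only [indicator_of_mem ht, ofPrimitive, zero_add, hprim, inner_smul_left,
          RCLike.conj_to_real]
      · simp only [hΦdef, indicator_of_notMem ht, map_zero, inner_zero_right, mul_zero]
    rw [h2, integral_add i1 i2, integral_const_mul] at h1
    have h3 := integral_inner_backward_difference_ge (ι := ι) hφ hω hh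
    linarith
  have hle : ω * D + ∫ r, inner ℝ (M r) (b' (Φ r)) ≤ 0 := by
    refine le_of_tendsto (((tendsto_one_sub_exp ω).mul_const D).add hlim) ?_
    filter_upwards [self_mem_nhdsWithin] with h hh
    exact key h hh
  have i1 : Integrable (fun t => Real.exp (2 * ω * t) * ‖ι (Φ t)‖ ^ 2) volume := by
    refine (integrable_inner_of_memLp (ι.comp_memLp' hM) (ι.comp_memLp' hΦ)).congr
      (Eventually.of_forall fun t => ?_)
    simp only [hMdef, Function.comp_apply, map_smul, inner_smul_left, real_inner_self_eq_norm_sq,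
      RCLike.conj_to_real]
  have i2 := integrable_inner_of_memLp hM hW
  have i3 : Integrable (fun t => Real.exp (2 * ω * t) * ‖Φ t‖ ^ 2) volume := by
    refine (integrable_inner_of_memLp hM hΦ).congr (Eventually.of_forall fun t => ?_)
    simp only [hMdef, inner_smul_left, real_inner_self_eq_norm_sq, RCLike.conj_to_real]
  have hcoer : α * ∫ t, Real.exp (2 * ω * t) * ‖Φ t‖ ^ 2 ≤ 0 := by
    refine le_trans ?_ hle
    rw [hD, ← integral_const_mul, ← integral_const_mul, ← integral_add (i1.const_mul _) i2]
    refine integral_mono (i3.const_mul _) ((i1.const_mul _).add i2) fun t => ?_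
    have h1 := mul_le_mul_of_nonneg_left (hb (Φ t)) (Real.exp_pos (2 * ω * t)).le
    simp only [hMdef, hb', map_smul, smul_apply, smul_eq_mul]
    linarith
  have hzero : ∫ t, Real.exp (2 * ω * t) * ‖Φ t‖ ^ 2 = 0 :=
    le_antisymm (by nlinarith) (integral_nonneg fun t => by positivity)
  have hΦ0 : Φ =ᵐ[volume] 0 := by
    have := (integral_eq_zero_iff_of_nonneg (fun t => by positivity) i3).1 hzero
    filter_upwards [this] with t ht
    simpa [(Real.exp_pos _).ne'] using ht
  have hsnd : x.snd = 0 := by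
    have h1 : φ =ᵐ[volume.restrict (Ioc 0 1)] 0 := by
      rw [Filter.EventuallyEq, ae_restrict_iff' measurableSet_Ioc]
      filter_upwards [hΦ0] with t ht hm
      rwa [hΦdef, indicator_of_mem hm] at ht
    rw [← volI_eq_restrict_Ioc] at h1
    exact (Lp.eq_zero_iff_ae_eq_zero).2 h1
  -- Once the second component is gone, constant trajectories test the first one against the dense
  -- range of `ι`.
  have hfst : x.fst = 0 := by
    refine hι.eq_zero_of_inner_right ℝ fun v => ?_
    have h1 := hort (ofPrimitive ι v (MemLp.zero (p := 2)))
    have h2 : ∀ᵐ t ∂volI, φ t = 0 := by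
      have := Lp.coeFn_zero V 2 volI
      rw [← hsnd] at this
      exact this
    rw [integral_congr_ae (g := fun _ => 0), integral_zero, add_zero] at h1
    · simpa [ofPrimitive] using h1
    · filter_upwards [h2] with t ht
      rw [show x.snd t = 0 from ht, map_zero]
  exact (WithLp.ofLp_injective 2) (Prod.ext hfst hsnd)

/-- A closed subspace of a Hilbert space with trivial orthogonal complement is everything. -/
theorem exists_solves {b : V →L[ℝ] V →L[ℝ] ℝ} {α ω : ℝ} (hα : 0 < α) (hω : 0 ≤ ω)
    (hb : IsGarding ι b α ω) (hι : DenseRange ι) (y₀ : H) (γ : Lp V 2 volI) :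
    ∃ y : Trajectory ι, y.Solves b γ ∧ y.rep 0 = y₀ := by
  have h1 : (solvableData ι b).topologicalClosure = ⊤ :=
    (Submodule.topologicalClosure_eq_top_iff).2 (orthogonal_solvableData hα hω hb hι)
  rw [(isClosed_solvableData hα hω hb).submodule_topologicalClosure_eq] at h1
  have h2 : WithLp.toLp 2 (y₀, γ) ∈ solvableData ι b := h1 ▸ Submodule.mem_top
  exact h2

end Trajectory

end Existence

/-! ### State and adjoint equation of a control system -/

section States

open Filter Topology

variable {V H : Type*}
  [NormedAddCommGroup V] [InnerProductSpace ℝ V] [CompleteSpace V]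
  [NormedAddCommGroup H] [InnerProductSpace ℝ H] [CompleteSpace H]
  {Ω : Type*} [MeasurableSpace Ω] {ϱ : Measure Ω}

theorem Trajectory.Solves.eq {ι : V →L[ℝ] H} {b : V →L[ℝ] V →L[ℝ] ℝ} {α ω : ℝ} (hα : 0 < α)
    (hω : 0 ≤ ω) (hb : IsGarding ι b α ω) {γ : Lp V 2 volI} {y z : Trajectory ι}
    (hy : y.Solves b γ) (hz : z.Solves b γ) (h0 : y.rep 0 = z.rep 0) :
    (∀ T ∈ Icc (0 : ℝ) 1, y.rep T = z.rep T) ∧ y.valLp = z.valLp := by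
  obtain ⟨C, -, hest⟩ := Trajectory.norm_estimate hα hω hb
  have h1 := hest _ _ (hy.comb hz 1 (-1))
  rw [Trajectory.valLp_comb] at h1
  simp only [Trajectory.comb, h0, one_smul, neg_one_smul, sub_self, norm_zero, add_zero,
    mul_zero, norm_le_zero_iff, ← sub_eq_add_neg, sub_eq_zero] at h1
  exact h1

namespace ControlSystem

variable (P : ControlSystem V H ϱ)

theorem exists_isGarding {ν : ℝ} (hν : 0 < ν) :
    ∃ α ω : ℝ, 0 < α ∧ 0 ≤ ω ∧ IsGarding P.ι (ν • P.a) α ω ∧ IsGarding P.ι (ν • P.a.flip) α ω := by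
  obtain ⟨α, ω, hα, hω, h⟩ := P.garding
  have key : ∀ v, ν * α * ‖v‖ ^ 2 ≤ ν * P.a v v + ν * ω * ‖P.ι v‖ ^ 2 := fun v => by
    have := mul_le_mul_of_nonneg_left (h v) hν.le
    linarith
  exact ⟨ν * α, ν * ω, by positivity, by positivity, fun v => key v, fun v => key v⟩

/-- The control operator as a map `L²(I;L²(ω)) → L²(I;V)`, up to the Riesz isomorphism. -/
def controlLp : Lp (Lp ℝ 2 ϱ) 2 volI →L[ℝ] Lp V 2 volI :=
  ContinuousLinearMap.compLpL 2 volI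
    ((riesz V).toContinuousLinearEquiv.toContinuousLinearMap.comp P.B)

/-- The operator `A` as a map `L²(I;V) → L²(I;V)`, up to the Riesz isomorphism. -/
def formLp : Lp V 2 volI →L[ℝ] Lp V 2 volI :=
  ContinuousLinearMap.compLpL 2 volI
    ((riesz V).toContinuousLinearEquiv.toContinuousLinearMap.comp P.a)

theorem coeFn_controlLp (u : Lp (Lp ℝ 2 ϱ) 2 volI) :
    ∀ᵐ t ∂volI, P.controlLp u t = riesz V (P.B (u t)) :=
  ContinuousLinearMap.coeFn_compLpL _ u

theorem coeFn_formLp (v : Lp V 2 volI) : ∀ᵐ t ∂volI, P.formLp v t = riesz V (P.a (v t)) :=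
  ContinuousLinearMap.coeFn_compLpL _ v

theorem isState_iff {ν : ℝ} {u : Lp (Lp ℝ 2 ϱ) 2 volI} {y : Trajectory P.ι} :
    P.IsState ν u y ↔ y.Solves (ν • P.a) (ν • P.controlLp u) ∧ y.rep 0 = P.y₀ := by
  refine and_congr_left fun _ => eventually_congr ?_
  filter_upwards [P.coeFn_controlLp u, Lp.coeFn_smul ν (P.controlLp u)] with t h1 h2
  rw [h2, Pi.smul_apply, h1, LinearIsometryEquiv.map_smul]
  have h3 := (InnerProductSpace.toDual ℝ V).apply_symm_apply (P.B (u t))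
  rw [h3]
  rfl

/-- Existence of some solution is what gives the `Classical.epsilon` choice its meaning. -/
theorem isState_S {ν : ℝ} (hν : 0 < ν) (u : Lp (Lp ℝ 2 ϱ) 2 volI) : P.IsState ν u (P.S ν u) := by
  obtain ⟨α, ω, hα, hω, hb, -⟩ := P.exists_isGarding hν
  obtain ⟨y, hy⟩ := Trajectory.exists_solves hα hω hb P.ι_dense P.y₀ (ν • P.controlLp u)
  exact Classical.epsilon_spec (p := P.IsState ν u) ⟨y, P.isState_iff.2 hy⟩

theorem solves_S {ν : ℝ} (hν : 0 < ν) (u : Lp (Lp ℝ 2 ϱ) 2 volI) :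
    (P.S ν u).Solves (ν • P.a) (ν • P.controlLp u) := (P.isState_iff.1 (P.isState_S hν u)).1

theorem S_rep_zero {ν : ℝ} (hν : 0 < ν) (u : Lp (Lp ℝ 2 ϱ) 2 volI) : (P.S ν u).rep 0 = P.y₀ :=
  (P.isState_iff.1 (P.isState_S hν u)).2

/-- Time reversal gives a forward equation for the transposed form, whose diagonal, hence Gårding
inequality, is the same. Existence and uniqueness thus carry over. -/
theorem isAdjoint_iff_reverse {ν : ℝ} {p₁ : H} {p : Trajectory P.ι} :
    P.IsAdjoint ν p₁ p ↔ p.reverse.Solves (ν • P.a.flip) 0 ∧ p.reverse.rep 0 = p₁ := by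
  have h1 : (∀ᵐ t ∂volI, -p.deriv t + ν • P.a.flip (p.val t) = 0) ↔
      ∀ᵐ t ∂volI, -p.deriv (1 - t) + ν • P.a.flip (p.val (1 - t)) = 0 := by
    refine ⟨fun h => measurePreserving_one_sub.quasiMeasurePreserving.ae h, fun h => ?_⟩
    have := measurePreserving_one_sub.quasiMeasurePreserving.ae h
    simpa only [sub_sub_cancel] using this
  refine and_congr (h1.trans (eventually_congr ?_)) ?_
  · filter_upwards [Lp.coeFn_zero V 2 volI] with t ht
    rw [ht, Pi.zero_apply, map_zero]
    rfl
  · simp [Trajectory.reverse]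

theorem isAdjoint_adjointState {ν : ℝ} (hν : 0 < ν) (p₁ : H) :
    P.IsAdjoint ν p₁ (P.adjointState ν p₁) := by
  obtain ⟨α, ω, hα, hω, -, hb⟩ := P.exists_isGarding hν
  obtain ⟨y, hy, hy0⟩ := Trajectory.exists_solves hα hω hb P.ι_dense p₁ 0
  refine Classical.epsilon_spec (p := P.IsAdjoint ν p₁) ⟨y.reverse, P.isAdjoint_iff_reverse.2 ?_⟩
  refine ⟨?_, by simpa [Trajectory.reverse] using hy0⟩
  filter_upwards [hy] with t ht
  simpa [Trajectory.reverse] using ht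

theorem valLp_reverse_eq {ι : V →L[ℝ] H} {p q : Trajectory ι}
    (h : p.reverse.valLp = q.reverse.valLp) : p.valLp = q.valLp := by
  have h1 : (fun t => p.val (1 - t)) =ᵐ[volI] fun t => q.val (1 - t) :=
    (MemLp.toLp_eq_toLp_iff p.reverse.memLp_val q.reverse.memLp_val).1 h
  have h2 := measurePreserving_one_sub.quasiMeasurePreserving.ae h1
  simp only [sub_sub_cancel] at h2
  exact (MemLp.toLp_eq_toLp_iff p.memLp_val q.memLp_val).2 h2

/-- Uniqueness makes the chosen adjoint state homogeneous in its terminal value, as a class in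
`L²(I;V)`. This links the multiplier `μ` to the normalized adjoint. -/
theorem valLp_adjointState_smul {ν : ℝ} (hν : 0 < ν) (c : ℝ) (p₁ : H) :
    (P.adjointState ν (c • p₁)).valLp = c • (P.adjointState ν p₁).valLp := by
  obtain ⟨α, ω, hα, hω, -, hb⟩ := P.exists_isGarding hν
  have h1 := P.isAdjoint_iff_reverse.1 (P.isAdjoint_adjointState hν (c • p₁))
  have h2 := P.isAdjoint_iff_reverse.1 (P.isAdjoint_adjointState hν p₁)
  have h3 := h2.1.comb h2.1 c 0
  rw [smul_zero, smul_zero, add_zero] at h3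
  have h4 := (h1.1.eq hα hω hb h3 (by
    rw [h1.2]; simp [Trajectory.comb, h2.2])).2
  have h5 : (P.adjointState ν p₁).reverse.comb c 0 (P.adjointState ν p₁).reverse =
      ((P.adjointState ν p₁).comb c 0 (P.adjointState ν p₁)).reverse := by
    simp [Trajectory.comb, Trajectory.reverse]
  rw [h5] at h4
  rw [valLp_reverse_eq h4, Trajectory.valLp_comb, zero_smul, add_zero]

/-- Duality between the linearized state equation and the adjoint equation. -/
theorem inner_rep_one_of_isAdjoint {ν : ℝ} {γ : Lp V 2 volI} {w p : Trajectory P.ι} {p₁ : H}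
    (hw : w.Solves (ν • P.a) γ) (hw0 : w.rep 0 = 0) (hp : P.IsAdjoint ν p₁ p) :
    inner ℝ (w.rep 1) p₁ = inner ℝ γ p.valLp := by
  have h1 := w.integral_by_parts p (T := 1) ⟨zero_le_one, le_rfl⟩
  rw [hw0, inner_zero_left, sub_zero, hp.2, ← setIntegral_Ioo_eq_intervalIntegral,
    ← setIntegral_Ioo_eq_intervalIntegral, ← integral_add
      (integrable_dual_apply w.memLp_deriv p.memLp_val)
      (integrable_dual_apply p.memLp_deriv w.memLp_val)] at h1
  rw [h1, L2.inner_def]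
  refine integral_congr_ae ?_
  filter_upwards [hw, hp.1, p.memLp_val.coeFn_toLp] with t h2 h3 h4
  have h5 : w.deriv t = InnerProductSpace.toDual ℝ V (γ t) - (ν • P.a) (w.val t) :=
    eq_sub_of_add_eq h2
  have h6 : p.deriv t = ν • P.a.flip (p.val t) := by
    rwa [neg_add_eq_zero] at h3
  simp only [Trajectory.valLp, h4, h5, h6, sub_apply, smul_apply, ContinuousLinearMap.flip_apply,
    InnerProductSpace.toDual_apply_apply]
  ring

/-- The right-hand side `B u - A y`, `y = S(ν,u)`, of the state equation as an element of
`L²(I;V)`, up to the Riesz isomorphism. -/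
def rate (ν : ℝ) (u : Lp (Lp ℝ 2 ϱ) 2 volI) : Lp V 2 volI :=
  P.controlLp u - P.formLp (P.S ν u).valLp

theorem hamiltonian_eq_inner (ν : ℝ) (u : Lp (Lp ℝ 2 ϱ) 2 volI) (p : Trajectory P.ι) :
    P.hamiltonian ν u p = inner ℝ (P.rate ν u) p.valLp := by
  rw [hamiltonian, L2.inner_def]
  refine integral_congr_ae ?_
  filter_upwards [P.coeFn_controlLp u, P.coeFn_formLp (P.S ν u).valLp, p.memLp_val.coeFn_toLp,
    (P.S ν u).memLp_val.coeFn_toLp, Lp.coeFn_sub (P.controlLp u) (P.formLp (P.S ν u).valLp)]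
    with t h1 h2 h3 h4 h5
  simp only [rate, Trajectory.valLp] at *
  rw [h3, h5, Pi.sub_apply, h1, h2, h4, ← map_sub, inner_riesz]

theorem integral_Badj_eq_inner (u v : Lp (Lp ℝ 2 ϱ) 2 volI) (p : Trajectory P.ι) :
    ∫ t in Ioo (0 : ℝ) 1, inner ℝ (P.Badj (p.val t)) (u t - v t) =
      inner ℝ (P.controlLp (u - v)) p.valLp := by
  rw [L2.inner_def]
  refine integral_congr_ae ?_
  filter_upwards [P.coeFn_controlLp (u - v), p.memLp_val.coeFn_toLp, Lp.coeFn_sub u v]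
    with t h1 h2 h3
  rw [h1, h3, Trajectory.valLp, h2, inner_riesz, Badj, InnerProductSpace.toDual_symm_apply]
  rfl

/-- A state for the parameter `ν` satisfies the equation with parameter `ν'` up to a
perturbation. -/
theorem solves_S_sub {ν ν' : ℝ} (hν : 0 < ν) (hν' : 0 < ν') (u : Lp (Lp ℝ 2 ϱ) 2 volI) :
    ((P.S ν u).comb 1 (-1) (P.S ν' u)).Solves (ν' • P.a) ((ν - ν') • P.rate ν u) := by
  have h1 : (P.S ν u).Solves (ν' • P.a) (ν' • P.controlLp u + (ν - ν') • P.rate ν u) := by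
    filter_upwards [P.solves_S hν u, P.coeFn_formLp (P.S ν u).valLp,
      (P.S ν u).memLp_val.coeFn_toLp, Lp.coeFn_sub (P.controlLp u) (P.formLp (P.S ν u).valLp),
      Lp.coeFn_smul ν (P.controlLp u), Lp.coeFn_smul ν' (P.controlLp u),
      Lp.coeFn_smul (ν - ν') (P.rate ν u),
      Lp.coeFn_add (ν' • P.controlLp u) ((ν - ν') • P.rate ν u)] with t h1 h2 h3 h4 h5 h6 h7 h8
    have h9 : InnerProductSpace.toDual ℝ V (P.formLp (P.S ν u).valLp t) =
        P.a ((P.S ν u).val t) := by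
      rw [h2, Trajectory.valLp, h3]
      exact (InnerProductSpace.toDual ℝ V).apply_symm_apply _
    rw [h5, Pi.smul_apply, LinearIsometryEquiv.map_smul] at h1
    rw [h8, Pi.add_apply, h6, h7, Pi.smul_apply, Pi.smul_apply, rate, h4, Pi.sub_apply, map_add,
      LinearIsometryEquiv.map_smul, LinearIsometryEquiv.map_smul, map_sub, h9]
    have h10 : (P.S ν u).deriv t = ν • InnerProductSpace.toDual ℝ V (P.controlLp u t) -
      (ν • P.a) ((P.S ν u).val t) := eq_sub_of_add_eq h1
    rw [h10]
    simp only [smul_apply]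
    module
  have h2 := h1.comb (P.solves_S hν' u) 1 (-1)
  convert h2 using 1
  module

/-- An exact identity with the rate at the perturbed parameter `ν`; replacing it by the rate at `ν'`
costs only a second-order error for bounded controls. -/
theorem inner_S_sub {ν ν' : ℝ} (hν : 0 < ν) (hν' : 0 < ν') (u : Lp (Lp ℝ 2 ϱ) 2 volI)
    {p : Trajectory P.ι} {p₁ : H} (hp : P.IsAdjoint ν' p₁ p) :
    inner ℝ ((P.S ν u).rep 1 - (P.S ν' u).rep 1) p₁ =
      (ν - ν') * inner ℝ (P.rate ν u) p.valLp := by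
  have := P.inner_rep_one_of_isAdjoint (P.solves_S_sub hν hν' u)
    (by simp [Trajectory.comb, P.S_rep_zero hν, P.S_rep_zero hν']) hp
  simpa [Trajectory.comb, ← sub_eq_add_neg, inner_smul_left] using this

theorem solves_S_sub_control {ν : ℝ} (hν : 0 < ν) (u v : Lp (Lp ℝ 2 ϱ) 2 volI) :
    ((P.S ν u).comb 1 (-1) (P.S ν v)).Solves (ν • P.a) (ν • P.controlLp (u - v)) := by
  have h2 := (P.solves_S hν u).comb (P.solves_S hν v) 1 (-1)
  convert h2 using 1
  rw [map_sub]
  module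

/-- This turns the variational inequality for `B* p` into an inequality between terminal states. -/
theorem inner_S_sub_control {ν : ℝ} (hν : 0 < ν) (u v : Lp (Lp ℝ 2 ϱ) 2 volI)
    {p : Trajectory P.ι} {p₁ : H} (hp : P.IsAdjoint ν p₁ p) :
    inner ℝ ((P.S ν u).rep 1 - (P.S ν v).rep 1) p₁ =
      ν * inner ℝ (P.controlLp (u - v)) p.valLp := by
  have := P.inner_rep_one_of_isAdjoint (P.solves_S_sub_control hν u v)
    (by simp [Trajectory.comb, P.S_rep_zero hν]) hp
  simpa [Trajectory.comb, ← sub_eq_add_neg, inner_smul_left] using this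

theorem S_affine {ν : ℝ} (hν : 0 < ν) (u v : Lp (Lp ℝ 2 ϱ) 2 volI) {c d : ℝ} (hcd : c + d = 1) :
    (P.S ν (c • u + d • v)).rep 1 = c • (P.S ν u).rep 1 + d • (P.S ν v).rep 1 ∧
      (P.S ν (c • u + d • v)).valLp = c • (P.S ν u).valLp + d • (P.S ν v).valLp := by
  obtain ⟨α, ω, hα, hω, hb, -⟩ := P.exists_isGarding hν
  have h1 := (P.solves_S hν u).comb (P.solves_S hν v) c d
  have h2 := P.solves_S hν (c • u + d • v)
  have h3 : ν • P.controlLp (c • u + d • v) =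
      c • (ν • P.controlLp u) + d • (ν • P.controlLp v) := by
    rw [map_add, map_smul, map_smul]
    module
  rw [h3] at h2
  have h4 := h2.eq hα hω hb h1 (by
    simp only [Trajectory.comb, P.S_rep_zero hν, ← add_smul, hcd, one_smul])
  rw [Trajectory.valLp_comb] at h4
  exact ⟨h4.1 1 ⟨zero_le_one, le_rfl⟩, h4.2⟩

theorem rate_affine {ν : ℝ} (hν : 0 < ν) (u v : Lp (Lp ℝ 2 ϱ) 2 volI) {c d : ℝ}
    (hcd : c + d = 1) : P.rate ν (c • u + d • v) = c • P.rate ν u + d • P.rate ν v := by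
  simp only [rate, (P.S_affine hν u v hcd).2, map_add, map_smul]
  module

theorem exists_norm_S_sub_control_le {ν : ℝ} (hν : 0 < ν) :
    ∃ C : ℝ, ∀ u v : Lp (Lp ℝ 2 ϱ) 2 volI,
      ‖(P.S ν u).rep 1 - (P.S ν v).rep 1‖ ≤ C * ‖u - v‖ ∧
      ‖(P.S ν u).valLp - (P.S ν v).valLp‖ ≤ C * ‖u - v‖ := by
  obtain ⟨α, ω, hα, hω, hb, -⟩ := P.exists_isGarding hν
  obtain ⟨C, hC, hest⟩ := Trajectory.norm_estimate hα hω hb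
  refine ⟨C * (ν * ‖P.controlLp‖), fun u v => ?_⟩
  have h1 := hest _ _ (P.solves_S_sub_control hν u v)
  have h2 : ((P.S ν u).comb 1 (-1) (P.S ν v)).rep 0 = 0 := by
    simp [Trajectory.comb, P.S_rep_zero hν]
  have h3 : C * (‖(0 : H)‖ + ‖ν • P.controlLp (u - v)‖) ≤ C * (ν * ‖P.controlLp‖) * ‖u - v‖ := by
    rw [norm_zero, zero_add, norm_smul, Real.norm_of_nonneg hν.le, mul_assoc, mul_assoc]
    gcongr
    exact P.controlLp.le_opNorm _
  rw [h2, Trajectory.valLp_comb, one_smul, neg_one_smul, ← sub_eq_add_neg] at h1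
  refine ⟨?_, h1.2.trans h3⟩
  have h4 := h1.1 1 ⟨zero_le_one, le_rfl⟩
  simp only [Trajectory.comb, one_smul, neg_one_smul, ← sub_eq_add_neg] at h4
  exact h4.trans h3

theorem continuous_S_rep_one {ν : ℝ} (hν : 0 < ν) :
    Continuous fun u : Lp (Lp ℝ 2 ϱ) 2 volI => (P.S ν u).rep 1 := by
  obtain ⟨C, hC⟩ := P.exists_norm_S_sub_control_le hν
  exact (LipschitzWith.of_dist_le' fun u v => by
    rw [dist_eq_norm, dist_eq_norm]; exact (hC u v).1).continuous

theorem continuous_rate {ν : ℝ} (hν : 0 < ν) :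
    Continuous fun u : Lp (Lp ℝ 2 ϱ) 2 volI => P.rate ν u := by
  obtain ⟨C, hC⟩ := P.exists_norm_S_sub_control_le hν
  have h1 : Continuous fun u : Lp (Lp ℝ 2 ϱ) 2 volI => (P.S ν u).valLp :=
    (LipschitzWith.of_dist_le' fun u v => by
      rw [dist_eq_norm, dist_eq_norm]; exact (hC u v).2).continuous
  exact P.controlLp.continuous.sub (P.formLp.continuous.comp h1)

/-- Lipschitz dependence on the parameter, uniformly for bounded controls. -/
theorem exists_norm_S_sub_le {ν₀ : ℝ} (hν₀ : 0 < ν₀) (M : ℝ) :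
    ∃ r C : ℝ, 0 < r ∧ 0 ≤ C ∧ ∀ u : Lp (Lp ℝ 2 ϱ) 2 volI, ‖u‖ ≤ M → ∀ ν : ℝ, |ν - ν₀| < r →
      0 < ν ∧ ‖(P.S ν u).rep 1 - (P.S ν₀ u).rep 1‖ ≤ C * |ν - ν₀| ∧
        ‖P.rate ν u - P.rate ν₀ u‖ ≤ C * |ν - ν₀| := by
  obtain ⟨α, ω, hα, hω, hb, -⟩ := P.exists_isGarding hν₀
  obtain ⟨C, hC, hest⟩ := Trajectory.norm_estimate hα hω hb
  set A := ‖P.formLp‖ with hA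
  set B := ‖P.controlLp‖ with hB
  have hA0 : 0 ≤ A := norm_nonneg P.formLp
  have hB0 : 0 ≤ B := norm_nonneg P.controlLp
  let K := C * (‖P.y₀‖ + ν₀ * (B * |M|))
  let L := 2 * (B * |M| + A * K)
  have hK : 0 ≤ K := by positivity
  have hL : 0 ≤ L := by positivity
  -- The first bound on the radius keeps `ν` positive; the second makes `A * C * |ν - ν₀| ≤ 1 / 2`,
  -- so that the rate, which appears in its own estimate, can be absorbed.
  refine ⟨min ν₀ (1 / (2 * C * (A + 1))), C * L + A * (C * L), by positivity, by positivity,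
    fun u hu ν hν => ?_⟩
  have hν1 : |ν - ν₀| < ν₀ := hν.trans_le (min_le_left _ _)
  have hν2 : |ν - ν₀| < 1 / (2 * C * (A + 1)) := hν.trans_le (min_le_right _ _)
  have hνpos : 0 < ν := by linarith [(abs_lt.1 hν1).1]
  have hBu : ‖P.controlLp u‖ ≤ B * |M| :=
    (P.controlLp.le_opNorm u).trans (mul_le_mul_of_nonneg_left (hu.trans (le_abs_self M)) hB0)
  have hy : ‖(P.S ν₀ u).valLp‖ ≤ K := by
    refine (hest _ _ (P.solves_S hν₀ u)).2.trans ?_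
    rw [P.S_rep_zero hν₀, norm_smul, Real.norm_of_nonneg hν₀.le]
    exact mul_le_mul_of_nonneg_left (by gcongr) hC.le
  have h1 := hest _ _ (P.solves_S_sub hνpos hν₀ u)
  have h2 : ((P.S ν u).comb 1 (-1) (P.S ν₀ u)).rep 0 = 0 := by
    simp [Trajectory.comb, P.S_rep_zero hν₀, P.S_rep_zero hνpos]
  rw [h2, norm_zero, zero_add, Trajectory.valLp_comb, one_smul, neg_one_smul, ← sub_eq_add_neg,
    norm_smul, Real.norm_eq_abs] at h1
  set ρ := ‖P.rate ν u‖ with hρ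
  set w := (P.S ν u).valLp - (P.S ν₀ u).valLp with hw
  have hρ0 : 0 ≤ ρ := norm_nonneg _
  have hw1 : ‖w‖ ≤ C * (|ν - ν₀| * ρ) := h1.2
  have hsmall : A * (C * |ν - ν₀|) ≤ 1 / 2 := by
    rw [lt_div_iff₀ (by positivity)] at hν2
    nlinarith [mul_nonneg hC.le (abs_nonneg (ν - ν₀))]
  have hρL : ρ ≤ L := by
    have h3 : P.rate ν u = P.controlLp u - P.formLp ((P.S ν₀ u).valLp + w) := by
      rw [rate, hw, add_sub_cancel]
    have h4 : ρ ≤ B * |M| + A * (K + ‖w‖) := by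
      rw [hρ, h3]
      refine (norm_sub_le _ _).trans (add_le_add hBu ((P.formLp.le_opNorm _).trans ?_))
      exact mul_le_mul_of_nonneg_left ((norm_add_le _ _).trans (by gcongr)) hA0
    have h5 : A * ‖w‖ ≤ 1 / 2 * ρ := by
      calc A * ‖w‖ ≤ A * (C * (|ν - ν₀| * ρ)) := by gcongr
        _ = A * (C * |ν - ν₀|) * ρ := by ring
        _ ≤ 1 / 2 * ρ := by gcongr
    simp only [L]
    linarith
  have hCL : C * (|ν - ν₀| * ρ) ≤ C * L * |ν - ν₀| := by
    rw [mul_comm |ν - ν₀| ρ, ← mul_assoc]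
    gcongr
  refine ⟨hνpos, ?_, ?_⟩
  · have h6 := h1.1 1 ⟨zero_le_one, le_rfl⟩
    simp only [Trajectory.comb, one_smul, neg_one_smul, ← sub_eq_add_neg] at h6
    refine h6.trans (hCL.trans ?_)
    have : 0 ≤ A * (C * L) * |ν - ν₀| := by positivity
    linarith
  · have h7 : P.rate ν u - P.rate ν₀ u = -P.formLp w := by
      rw [rate, rate, hw, map_sub]
      abel
    rw [h7, norm_neg]
    calc ‖P.formLp w‖ ≤ A * ‖w‖ := P.formLp.le_opNorm _
      _ ≤ A * (C * L * |ν - ν₀|) := by gcongr; exact hw1.trans hCL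
      _ ≤ _ := by
        have : 0 ≤ C * L * |ν - ν₀| := by positivity
        linarith

end ControlSystem

end States

/-! ### Admissible controls -/

section Admissible

open Filter Topology

variable {V H : Type*}
  [NormedAddCommGroup V] [InnerProductSpace ℝ V] [CompleteSpace V]
  [NormedAddCommGroup H] [InnerProductSpace ℝ H] [CompleteSpace H]
  {Ω : Type*} [MeasurableSpace Ω] {ϱ : Measure Ω}

/-- An `L²` limit is an a.e. limit along a subsequence. Applied twice: to the pointwise bounds on
`Ω`, then to membership in `Uad` in time. -/
theorem isClosed_setOf_ae_mem {α E : Type*} {mα : MeasurableSpace α} {μ : Measure α}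
    [NormedAddCommGroup E] {s : α → Set E} (hs : ∀ x, IsClosed (s x)) :
    IsClosed {u : Lp E 2 μ | ∀ᵐ x ∂μ, u x ∈ s x} := by
  refine IsSeqClosed.isClosed fun u v hu hv => ?_
  obtain ⟨ns, -, hae⟩ := (tendstoInMeasure_of_tendsto_Lp hv).exists_seq_tendsto_ae
  have hall : ∀ᵐ x ∂μ, ∀ n, u n x ∈ s x := ae_all_iff.2 hu
  filter_upwards [hae, hall] with x h1 h2
  exact (hs x).mem_of_tendsto h1 (Eventually.of_forall fun n => h2 _)

theorem convex_setOf_ae_mem {α E : Type*} {mα : MeasurableSpace α} {μ : Measure α}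
    [NormedAddCommGroup E] [NormedSpace ℝ E] {s : α → Set E} (hs : ∀ x, Convex ℝ (s x)) :
    Convex ℝ {u : Lp E 2 μ | ∀ᵐ x ∂μ, u x ∈ s x} := by
  intro u hu v hv a b ha hb hab
  filter_upwards [hu, hv, Lp.coeFn_add (a • u) (b • v), Lp.coeFn_smul a u, Lp.coeFn_smul b v]
    with x h1 h2 h3 h4 h5
  rw [h3, Pi.add_apply, h4, h5]
  exact hs x h1 h2 ha hb hab

namespace ControlSystem

variable (P : ControlSystem V H ϱ)

theorem isClosed_Uad : IsClosed P.Uad :=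
  isClosed_setOf_ae_mem (s := fun x => Icc (P.ua x) (P.ub x)) fun _ => isClosed_Icc

theorem convex_Uad : Convex ℝ P.Uad :=
  convex_setOf_ae_mem (s := fun x => Icc (P.ua x) (P.ub x)) fun _ => convex_Icc _ _

theorem isClosed_UadI : IsClosed P.UadI := isClosed_setOf_ae_mem fun _ => P.isClosed_Uad

theorem convex_UadI : Convex ℝ P.UadI := convex_setOf_ae_mem fun _ => P.convex_Uad

theorem exists_norm_le_of_mem_UadI (hbdd : Bornology.IsBounded P.Uad) :
    ∃ M : ℝ, ∀ u ∈ P.UadI, ‖u‖ ≤ M := by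
  obtain ⟨M, hM, h⟩ := hbdd.exists_pos_norm_le
  refine ⟨M, fun u hu => ?_⟩
  have h1 : ∀ᵐ t ∂volI, ‖u t‖ ≤ M := by
    have hu' : ∀ᵐ t ∂volI, u t ∈ P.Uad := hu
    exact hu'.mono fun t ht => h _ ht
  have h2 := Lp.norm_le_of_ae_bound hM.le h1
  simpa [measureUnivNNReal] using h2

end ControlSystem

end Admissible

/-! ### Differentiability of a minimal value function -/

section ValueFunction

open Filter Topology

variable {U : Type*} [NormedAddCommGroup U] [InnerProductSpace ℝ U] [CompleteSpace U]

/-- A decreasing sequence of nonempty closed convex sets, the first being bounded, has nonempty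
intersection in a Hilbert space. -/
theorem nonempty_iInter_of_antitone_convex {K : ℕ → Set U} (hanti : Antitone K)
    (hne : ∀ n, (K n).Nonempty) (hcl : ∀ n, IsClosed (K n)) (hconv : ∀ n, Convex ℝ (K n)) {M : ℝ}
    (hM : ∀ u ∈ K 0, ‖u‖ ≤ M) : (⋂ n, K n).Nonempty := by
  choose x hx hmin using fun n =>
    exists_norm_eq_iInf_of_complete_convex (hne n) (hcl n).isComplete (hconv n) 0
  have hle : ∀ n, ∀ u ∈ K n, ‖x n‖ ≤ ‖u‖ := by
    intro n u hu
    have h1 := hmin n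
    simp only [zero_sub, norm_neg] at h1
    rw [h1]
    exact ciInf_le ⟨0, by rintro _ ⟨w, rfl⟩; exact norm_nonneg _⟩ (⟨u, hu⟩ : K n)
  have hmono : Monotone fun n => ‖x n‖ := fun m n hmn => hle m _ (hanti hmn (hx n))
  have hbdd : BddAbove (range fun n => ‖x n‖) := by
    refine ⟨M, ?_⟩
    rintro _ ⟨n, rfl⟩
    exact hM _ (hanti (Nat.zero_le n) (hx n))
  have hlim := tendsto_atTop_ciSup hmono hbdd
  -- The midpoint of two minimal-norm elements lies in the larger set, so the parallelogram law
  -- bounds their distance by the increase of the squared norms.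
  have hpar : ∀ m n, m ≤ n → ‖x n - x m‖ ^ 2 ≤ 2 * (‖x n‖ ^ 2 - ‖x m‖ ^ 2) := by
    intro m n hmn
    have h1 := hle m _ (hconv m (hx m) (hanti hmn (hx n)) (a := 1 / 2) (b := 1 / 2)
      (by norm_num) (by norm_num) (by norm_num))
    have h2 : ‖(1 / 2 : ℝ) • x m + (1 / 2 : ℝ) • x n‖ = 1 / 2 * ‖x n + x m‖ := by
      rw [← smul_add, norm_smul, add_comm]
      norm_num
    rw [h2] at h1
    have h3 := parallelogram_law_with_norm ℝ (x n) (x m)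
    nlinarith [norm_nonneg (x m), norm_nonneg (x n + x m)]
  have hcau : CauchySeq x := by
    rw [Metric.cauchySeq_iff']
    intro ε hε
    have hsq := (hlim.pow 2).cauchySeq
    rw [Metric.cauchySeq_iff'] at hsq
    obtain ⟨N, hN⟩ := hsq (ε ^ 2 / 2) (by positivity)
    refine ⟨N, fun n hn => ?_⟩
    have h1 := (le_abs_self _).trans_lt (hN n hn)
    have h2 := hpar N n hn
    rw [dist_eq_norm]
    refine lt_of_pow_lt_pow_left₀ 2 hε.le ?_
    linarith
  obtain ⟨y, hy⟩ := cauchySeq_tendsto_of_complete hcau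
  refine ⟨y, mem_iInter.2 fun n => (hcl n).mem_of_tendsto hy ?_⟩
  filter_upwards [eventually_ge_atTop n] with m hm
  exact hanti hm (hx m)

/-- If an affine continuous functional is constant on the set of minimizers of a convex continuous
function on a bounded closed convex set, then it is almost constant on almost minimizers. -/
theorem exists_forall_lt_of_almost_minimizer {K : Set U} (hcl : IsClosed K)
    {M : ℝ} (hM : ∀ u ∈ K, ‖u‖ ≤ M) {φ G : U → ℝ} (hφ : Continuous φ) (hφc : ConvexOn ℝ K φ)
    (hG : Continuous G)
    (hGa : ∀ u v (c d : ℝ), c + d = 1 → G (c • u + d • v) = c * G u + d * G v) {m g : ℝ}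
    (hmin : ∀ u ∈ K, φ u ≤ m → G u = g) {ε : ℝ} (hε : 0 < ε) :
    ∃ η > 0, ∀ u ∈ K, φ u ≤ m + η → G u < g + ε := by
  by_contra! hcon
  have hpos : ∀ n : ℕ, (0 : ℝ) < 1 / (n + 1) := fun n => by positivity
  -- A common point of these nested closed convex sets would be a minimizer with `G ≥ g + ε`.
  -- Convexity stands in for weak compactness; `G` being affine makes its superlevel set convex.
  let S : ℕ → Set U := fun n => {u ∈ K | φ u ≤ m + 1 / (n + 1)} ∩ {u | g + ε ≤ G u}
  have hS : (⋂ n, S n).Nonempty := by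
    refine nonempty_iInter_of_antitone_convex (M := M) ?_ ?_ ?_ ?_ ?_
    · rintro i j hij u ⟨⟨h1, h2⟩, h3⟩
      refine ⟨⟨h1, h2.trans ?_⟩, h3⟩
      have := Nat.one_div_le_one_div (α := ℝ) hij
      linarith
    · intro n
      obtain ⟨u, h1, h2, h3⟩ := hcon _ (hpos n)
      exact ⟨u, ⟨h1, h2⟩, h3⟩
    · intro n
      exact (hcl.inter (isClosed_le hφ continuous_const)).inter (isClosed_le continuous_const hG)
    · intro n
      refine (hφc.convex_le _).inter fun u hu v hv c d hc hd hcd => ?_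
      simp only [mem_ofPred_eq] at hu hv ⊢
      rw [hGa u v c d hcd]
      calc g + ε = c * (g + ε) + d * (g + ε) := by rw [← add_mul, hcd, one_mul]
        _ ≤ _ := by gcongr
    · rintro u ⟨⟨h1, -⟩, -⟩
      exact hM u h1
  obtain ⟨u, hu⟩ := hS
  have hu' := mem_iInter.1 hu
  have h1 : φ u ≤ m := by
    refine le_of_forall_pos_le_add fun δ hδ => ?_
    obtain ⟨k, hk⟩ := exists_nat_one_div_lt hδ
    have := (hu' k).1.2
    linarith
  have h2 := hmin u (hu' 0).1.1 h1
  have h3 : g + ε ≤ G u := (hu' 0).2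
  linarith

/-- Danskin's theorem for a value function over a bounded closed convex set of a Hilbert space. -/
theorem hasDerivAt_sInf_image {K : Set U} (hcl : IsClosed K)
    {M : ℝ} (hM : ∀ u ∈ K, ‖u‖ ≤ M) {f : ℝ → U → ℝ} {G : U → ℝ} {ν₀ r C B : ℝ} {u₀ : U}
    (hu₀ : u₀ ∈ K) (hr : 0 < r) (hC : 0 ≤ C) (hB : ∀ ν u, B ≤ f ν u)
    (hf : Continuous (f ν₀)) (hfc : ConvexOn ℝ K (f ν₀)) (hG : Continuous G)
    (hGa : ∀ u v (c d : ℝ), c + d = 1 → G (c • u + d • v) = c * G u + d * G v)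
    (hmin : ∀ u ∈ K, f ν₀ u₀ ≤ f ν₀ u) (hGmin : ∀ u ∈ K, f ν₀ u ≤ f ν₀ u₀ → G u = G u₀)
    (hlip : ∀ u ∈ K, ∀ ν, |ν - ν₀| < r → |f ν u - f ν₀ u| ≤ C * |ν - ν₀|)
    (hlower : ∀ u ∈ K, ∀ ν, |ν - ν₀| < r →
      f ν₀ u₀ + (ν - ν₀) * G u - C * (ν - ν₀) ^ 2 ≤ f ν u)
    (hupper : ∀ ν, |ν - ν₀| < r → f ν u₀ ≤ f ν₀ u₀ + (ν - ν₀) * G u₀ + C * (ν - ν₀) ^ 2) :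
    HasDerivAt (fun ν => sInf (f ν '' K)) (G u₀) ν₀ := by
  have hbdd : ∀ ν, BddBelow (f ν '' K) := fun ν =>
    ⟨B, by rintro _ ⟨u, -, rfl⟩; exact hB ν u⟩
  have hne : ∀ ν, (f ν '' K).Nonempty := fun ν => ⟨_, mem_image_of_mem _ hu₀⟩
  have h0 : sInf (f ν₀ '' K) = f ν₀ u₀ :=
    le_antisymm (csInf_le (hbdd _) (mem_image_of_mem _ hu₀))
      (le_csInf (hne _) (by rintro _ ⟨u, hu, rfl⟩; exact hmin u hu))
  rw [hasDerivAt_iff_isLittleO, Asymptotics.isLittleO_iff]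
  intro ε hε
  obtain ⟨η₁, hη₁, H1⟩ := exists_forall_lt_of_almost_minimizer hcl hM hf hfc hG hGa
    (m := f ν₀ u₀) (g := G u₀) hGmin (half_pos hε)
  obtain ⟨η₂, hη₂, H2⟩ := exists_forall_lt_of_almost_minimizer hcl hM hf hfc
    (G := fun u => -G u) hG.neg
    (fun u v c d hcd => by rw [hGa u v c d hcd]; ring) (m := f ν₀ u₀) (g := -G u₀)
    (fun u hu h => by rw [hGmin u hu h]) (half_pos hε)
  have hη : 0 < min η₁ η₂ := lt_min hη₁ hη₂
  have hev1 : ∀ᶠ ν in 𝓝 ν₀, |ν - ν₀| < r := by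
    have : Tendsto (fun ν : ℝ => |ν - ν₀|) (𝓝 ν₀) (𝓝 |ν₀ - ν₀|) :=
      (continuous_id.sub continuous_const).abs.tendsto _
    rw [sub_self, abs_zero] at this
    exact this.eventually (gt_mem_nhds hr)
  have hev2 : ∀ᶠ ν in 𝓝 ν₀, (|G u₀| + 2 * C + 1) * |ν - ν₀| + |ν - ν₀| ^ 2 * (C + 1) <
      min η₁ η₂ := by
    have : Tendsto (fun ν : ℝ => (|G u₀| + 2 * C + 1) * |ν - ν₀| + |ν - ν₀| ^ 2 * (C + 1)) (𝓝 ν₀)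
        (𝓝 ((|G u₀| + 2 * C + 1) * |ν₀ - ν₀| + |ν₀ - ν₀| ^ 2 * (C + 1))) :=
      (by fun_prop : Continuous fun ν : ℝ =>
        (|G u₀| + 2 * C + 1) * |ν - ν₀| + |ν - ν₀| ^ 2 * (C + 1)).tendsto _
    rw [sub_self, abs_zero] at this
    rw [mul_zero, zero_pow two_ne_zero, zero_mul, add_zero] at this
    exact this.eventually (gt_mem_nhds hη)
  have hev3 : ∀ᶠ ν in 𝓝 ν₀, (C + 1) * |ν - ν₀| < ε / 2 := by
    have : Tendsto (fun ν : ℝ => (C + 1) * |ν - ν₀|) (𝓝 ν₀) (𝓝 ((C + 1) * |ν₀ - ν₀|)) :=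
      (by fun_prop : Continuous fun ν : ℝ => (C + 1) * |ν - ν₀|).tendsto _
    rw [sub_self, abs_zero, mul_zero] at this
    exact this.eventually (gt_mem_nhds (half_pos hε))
  filter_upwards [hev1, hev2, hev3] with ν hν1 hν2 hν3
  rw [h0, smul_eq_mul, Real.norm_eq_abs, Real.norm_eq_abs]
  set t := ν - ν₀ with ht
  rcases eq_or_ne t 0 with h00 | hne0
  · have : ν = ν₀ := by linarith
    rw [this, h0, h00]
    simp
  have htpos : 0 < |t| := abs_pos.2 hne0
  have hsq : t ^ 2 = |t| ^ 2 := (sq_abs t).symm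
  have hup : sInf (f ν '' K) ≤ f ν₀ u₀ + t * G u₀ + C * t ^ 2 :=
    (csInf_le (hbdd ν) (mem_image_of_mem _ hu₀)).trans (hupper ν hν1)
  -- A control within `t²` of the infimum suffices: the loss is of higher order, and no minimizer at
  -- `ν` is needed.
  obtain ⟨_, ⟨u, hu, rfl⟩, hu2⟩ := exists_lt_of_csInf_lt (hne ν)
    (lt_add_of_pos_right (sInf (f ν '' K)) (show 0 < t ^ 2 by positivity))
  have hl1 := hlip u hu ν hν1
  have hl2 := hlower u hu ν hν1
  have htG : t * G u₀ ≤ |t| * |G u₀| := by rw [← abs_mul]; exact le_abs_self _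
  -- The Lipschitz bound in `ν` makes this control a near-minimizer at `ν₀` too, so `G u` is close
  -- to `G u₀`.
  have hfu : f ν₀ u ≤ f ν₀ u₀ + min η₁ η₂ := by
    have := (abs_le.1 hl1).1
    nlinarith
  have hG1 := H1 u hu (hfu.trans (by gcongr; exact min_le_left _ _))
  have hG2 := H2 u hu (hfu.trans (by gcongr; exact min_le_right _ _))
  have hGd : |G u - G u₀| ≤ ε / 2 := abs_le.2 ⟨by linarith, by linarith⟩
  have htd : -(|t| * (ε / 2)) ≤ t * (G u - G u₀) := by
    have h1 : |t * (G u - G u₀)| ≤ |t| * (ε / 2) := by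
      rw [abs_mul]
      gcongr
    exact (abs_le.1 h1).1
  have hCt : (C + 1) * |t| ^ 2 ≤ ε / 2 * |t| := by
    rw [sq, ← mul_assoc]
    gcongr
  rw [abs_le]
  constructor <;> nlinarith

end ValueFunction

/-! ### The minimal distance value function -/

section MinimalDistance

open Filter Topology

/-- The right-hand side equals `(‖x‖² + ‖y‖²) / (2 ‖x‖)`, so this is the arithmetic-geometric mean
inequality. It gives the upper expansion of the distance, `inner_normalize_le_norm` the lower one.
-/
theorem norm_le_add_inner_add_sq {H : Type*} [NormedAddCommGroup H] [InnerProductSpace ℝ H]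
    {x y : H} (hx : x ≠ 0) :
    ‖y‖ ≤ ‖x‖ + inner ℝ (y - x) (‖x‖⁻¹ • x) + (2 * ‖x‖)⁻¹ * ‖y - x‖ ^ 2 := by
  have hx0 : 0 < ‖x‖ := norm_pos_iff.2 hx
  have h1 : ‖y‖ ^ 2 = ‖x‖ ^ 2 + 2 * inner ℝ x (y - x) + ‖y - x‖ ^ 2 := by
    have := norm_add_sq_real x (y - x)
    rwa [add_sub_cancel] at this
  have h2 : ‖x‖ + inner ℝ (y - x) (‖x‖⁻¹ • x) + (2 * ‖x‖)⁻¹ * ‖y - x‖ ^ 2 =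
      (‖x‖ ^ 2 + ‖y‖ ^ 2) / (2 * ‖x‖) := by
    rw [inner_smul_right, real_inner_comm, h1]
    field_simp
    ring
  rw [h2, le_div_iff₀ (by positivity)]
  nlinarith [sq_nonneg (‖x‖ - ‖y‖)]

theorem inner_normalize_le_norm {H : Type*} [NormedAddCommGroup H] [InnerProductSpace ℝ H]
    (x y : H) : inner ℝ y (‖x‖⁻¹ • x) ≤ ‖y‖ := by
  refine (real_inner_le_norm _ _).trans ?_
  rw [norm_smul, norm_inv, norm_norm]
  exact mul_le_of_le_one_right (norm_nonneg _) (inv_mul_le_one (a := ‖x‖))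

variable {V H : Type*}
  [NormedAddCommGroup V] [InnerProductSpace ℝ V] [CompleteSpace V]
  [NormedAddCommGroup H] [InnerProductSpace ℝ H] [CompleteSpace H]
  {Ω : Type*} [MeasurableSpace Ω] {ϱ : Measure Ω}

namespace ControlSystem

variable (P : ControlSystem V H ϱ)

/-- The terminal residual `S(ν,u)(1) - y_d`. -/
def residual (ν : ℝ) (u : Lp (Lp ℝ 2 ϱ) 2 volI) : H := (P.S ν u).rep 1 - P.yd

theorem f_eq (ν : ℝ) (u : Lp (Lp ℝ 2 ϱ) 2 volI) : P.f ν u = ‖P.residual ν u‖ - P.δ₀ := rfl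

theorem residual_sub (ν ν' : ℝ) (u v : Lp (Lp ℝ 2 ϱ) 2 volI) :
    P.residual ν u - P.residual ν' v = (P.S ν u).rep 1 - (P.S ν' v).rep 1 := by
  rw [residual, residual, sub_sub_sub_cancel_right]

theorem residual_affine {ν : ℝ} (hν : 0 < ν) (u v : Lp (Lp ℝ 2 ϱ) 2 volI) {c d : ℝ}
    (hcd : c + d = 1) :
    P.residual ν (c • u + d • v) = c • P.residual ν u + d • P.residual ν v := by
  have h1 : P.yd = c • P.yd + d • P.yd := by rw [← add_smul, hcd, one_smul]
  rw [residual, (P.S_affine hν u v hcd).1, residual, residual]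
  nth_rewrite 1 [h1]
  module

theorem continuous_residual {ν : ℝ} (hν : 0 < ν) : Continuous (P.residual ν) :=
  (P.continuous_S_rep_one hν).sub continuous_const

theorem convexOn_f {ν : ℝ} (hν : 0 < ν) : ConvexOn ℝ P.UadI (P.f ν) := by
  refine ⟨P.convex_UadI, fun u _ v _ c d hc hd hcd => ?_⟩
  rw [f_eq, f_eq, f_eq, P.residual_affine hν u v hcd, smul_eq_mul, smul_eq_mul]
  have h1 := norm_add_le (c • P.residual ν u) (d • P.residual ν v)
  rw [norm_smul, norm_smul, Real.norm_of_nonneg hc, Real.norm_of_nonneg hd] at h1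
  have h2 : P.δ₀ = c * P.δ₀ + d * P.δ₀ := by rw [← add_mul, hcd, one_mul]
  linarith

/-- The projection inequality for distance-optimal controls. -/
theorem inner_residual_sub_nonneg {ν : ℝ} (hν : 0 < ν) {u v : Lp (Lp ℝ 2 ϱ) 2 volI}
    (hu : u ∈ P.distanceOptimal ν) (hv : v ∈ P.UadI) :
    0 ≤ inner ℝ (P.residual ν v - P.residual ν u) (P.residual ν u) := by
  by_contra! hneg
  set x := P.residual ν u with hx
  set w := P.residual ν v - x with hw
  have key : ∀ s : ℝ, 0 ≤ s → s ≤ 1 → 0 ≤ 2 * s * inner ℝ w x + s ^ 2 * ‖w‖ ^ 2 := by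
    intro s hs0 hs1
    have h1 := hu.2 _ (P.convex_UadI hu.1 hv (sub_nonneg.2 hs1) hs0 (sub_add_cancel 1 s))
    change ‖P.residual ν u‖ ≤ ‖P.residual ν _‖ at h1
    rw [P.residual_affine hν u v (sub_add_cancel 1 s), ← hx] at h1
    have h2 : (1 - s) • x + s • P.residual ν v = x + s • w := by rw [hw]; module
    rw [h2] at h1
    have h3 := norm_add_sq_real x (s • w)
    rw [inner_smul_right, norm_smul, mul_pow, Real.norm_eq_abs, sq_abs, real_inner_comm] at h3
    have h4 : ‖x‖ ^ 2 ≤ ‖x + s • w‖ ^ 2 := by gcongr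
    linarith
  have hq : 0 < ‖w‖ ^ 2 + 1 := by positivity
  set i := inner ℝ w x with hi
  -- A step on which the quadratic in `key` is negative; the `+ 1` keeps the denominator positive
  -- when `w = 0`.
  let s := min 1 (-i / (‖w‖ ^ 2 + 1))
  have hs0 : 0 < s := lt_min one_pos (div_pos (neg_pos.2 hneg) hq)
  have h1 := key s hs0.le (min_le_left _ _)
  have h2 : s * (‖w‖ ^ 2 + 1) ≤ -i := by
    rw [← le_div_iff₀ hq]
    exact min_le_right _ _
  nlinarith

/-- The projection inequality gives `‖r_v - r_u‖² ≤ ‖r_v‖² - ‖r_u‖²`. Hence all minimizers have the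
same normalized adjoint state. -/
theorem residual_eq_of_distanceOptimal {ν : ℝ} (hν : 0 < ν) {u v : Lp (Lp ℝ 2 ϱ) 2 volI}
    (hu : u ∈ P.distanceOptimal ν) (hv : v ∈ P.UadI) (hle : ‖P.residual ν v‖ ≤ ‖P.residual ν u‖) :
    P.residual ν v = P.residual ν u := by
  have h1 := P.inner_residual_sub_nonneg hν hu hv
  have h2 := norm_add_sq_real (P.residual ν u) (P.residual ν v - P.residual ν u)
  rw [add_sub_cancel, real_inner_comm] at h2
  have h3 : ‖P.residual ν v‖ ^ 2 ≤ ‖P.residual ν u‖ ^ 2 := by gcongr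
  have h4 : ‖P.residual ν v - P.residual ν u‖ ^ 2 ≤ 0 := by linarith
  have h5 : ‖P.residual ν v - P.residual ν u‖ = 0 := by
    nlinarith [norm_nonneg (P.residual ν v - P.residual ν u)]
  exact sub_eq_zero.1 (norm_eq_zero.1 h5)

/-- The adjoint is frozen at the one of `u₀`, so `G` is affine, and it agrees with the Hamiltonian
integral at every minimizer. -/
theorem hasDerivAt_delta (hbdd : Bornology.IsBounded P.Uad) {ν₀ : ℝ} (hν₀ : 0 < ν₀)
    {u₀ : Lp (Lp ℝ 2 ϱ) 2 volI} (hu₀ : u₀ ∈ P.distanceOptimal ν₀) (hne : P.residual ν₀ u₀ ≠ 0)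
    (hind : P.ControlIndependent ν₀) :
    HasDerivAt P.delta (P.hamiltonian ν₀ u₀ (P.normalizedAdjoint ν₀ u₀)) ν₀ := by
  set x := P.residual ν₀ u₀ with hx
  set e := ‖x‖⁻¹ • x with he
  set p := P.adjointState ν₀ e
  have hp : P.IsAdjoint ν₀ e p := P.isAdjoint_adjointState hν₀ e
  have hx0 : 0 < ‖x‖ := norm_pos_iff.2 hne
  have hxe : inner ℝ x e = ‖x‖ := by
    rw [he, inner_smul_right, real_inner_self_eq_norm_sq]
    field_simp
  obtain ⟨M, hM⟩ := P.exists_norm_le_of_mem_UadI hbdd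
  obtain ⟨r, C, hr, hC, hpert⟩ := P.exists_norm_S_sub_le hν₀ M
  let G : Lp (Lp ℝ 2 ϱ) 2 volI → ℝ := fun u => inner ℝ (P.rate ν₀ u) p.valLp
  have hG : P.hamiltonian ν₀ u₀ (P.normalizedAdjoint ν₀ u₀) = G u₀ := P.hamiltonian_eq_inner _ _ _
  rw [hG]
  have hexp : ∀ u ∈ P.UadI, ∀ ν, |ν - ν₀| < r →
      |inner ℝ (P.residual ν u - P.residual ν₀ u) e - (ν - ν₀) * G u| ≤
        C * ‖p.valLp‖ * (ν - ν₀) ^ 2 := by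
    intro u hu ν hν
    obtain ⟨hνpos, -, h2⟩ := hpert u (hM u hu) ν hν
    rw [P.residual_sub, P.inner_S_sub hνpos hν₀ u hp, ← mul_sub, ← inner_sub_left, abs_mul]
    calc |ν - ν₀| * |inner ℝ (P.rate ν u - P.rate ν₀ u) p.valLp|
        ≤ |ν - ν₀| * (C * |ν - ν₀| * ‖p.valLp‖) := by
          gcongr
          exact (abs_real_inner_le_norm _ _).trans (by gcongr)
      _ = C * ‖p.valLp‖ * |ν - ν₀| ^ 2 := by ring
      _ = _ := by rw [sq_abs]
  -- The summands cover the Lipschitz bound, the remainder of the expansion along `e`, and the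
  -- curvature of the norm at `x`.
  let C' := C + C * ‖p.valLp‖ + (2 * ‖x‖)⁻¹ * C ^ 2
  have hC' : 0 ≤ C' := by positivity
  have hCle : C ≤ C' := by
    have : 0 ≤ C * ‖p.valLp‖ + (2 * ‖x‖)⁻¹ * C ^ 2 := by positivity
    simp only [C']
    linarith
  refine hasDerivAt_sInf_image (K := P.UadI) (f := P.f) (r := r) (C := C') (B := -P.δ₀)
    P.isClosed_UadI hM hu₀.1 hr hC' ?_ ?_ (P.convexOn_f hν₀) ?_ ?_ ?_ ?_ ?_ ?_ ?_
  · intro ν u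
    rw [f_eq]
    linarith [norm_nonneg (P.residual ν u)]
  · exact (P.continuous_residual hν₀).norm.sub continuous_const
  · exact (P.continuous_rate hν₀).inner continuous_const
  · intro u v c d hcd
    simp only [G, P.rate_affine hν₀ u v hcd, inner_add_left, inner_smul_left, RCLike.conj_to_real]
  · intro u hu
    exact sub_le_sub_right (hu₀.2 u hu) _
  · intro u hu hle
    have h1 : ‖P.residual ν₀ u‖ ≤ ‖P.residual ν₀ u₀‖ := by
      rw [f_eq, f_eq] at hle
      linarith
    have h2 := P.residual_eq_of_distanceOptimal hν₀ hu₀ hu h1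
    have h3 : u ∈ P.distanceOptimal ν₀ := ⟨hu, fun v hv => h1.trans (hu₀.2 v hv)⟩
    have h4 := hind u h3 u₀ hu₀
    have h5 : P.normalizedAdjoint ν₀ u = P.normalizedAdjoint ν₀ u₀ := by
      change P.adjointState ν₀ (‖P.residual ν₀ u‖⁻¹ • P.residual ν₀ u) = _
      rw [h2]
      rfl
    rw [h5, hG, hamiltonian_eq_inner] at h4
    exact h4
  · intro u hu ν hν
    have h1 := (hpert u (hM u hu) ν hν).2.1
    rw [← P.residual_sub] at h1
    rw [f_eq, f_eq, sub_sub_sub_cancel_right]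
    exact (abs_norm_sub_norm_le _ _).trans (h1.trans (by gcongr))
  -- The lower bound must hold for all admissible `u`: the norm dominates its component along `e`,
  -- and by the projection inequality that component at `ν₀` is smallest at `u₀`.
  · intro u hu ν hν
    have h1 := (abs_le.1 (hexp u hu ν hν)).1
    have h2 : 0 ≤ inner ℝ (P.residual ν₀ u - x) e := by
      rw [he, inner_smul_right]
      exact mul_nonneg (inv_nonneg.2 hx0.le) (P.inner_residual_sub_nonneg hν₀ hu₀ hu)
    have h3 := inner_normalize_le_norm x (P.residual ν u)
    rw [inner_sub_left] at h1 h2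
    rw [f_eq, f_eq, ← hx]
    have h4 : C * ‖p.valLp‖ * (ν - ν₀) ^ 2 ≤ C' * (ν - ν₀) ^ 2 := by
      gcongr
      have : 0 ≤ (2 * ‖x‖)⁻¹ * C ^ 2 := by positivity
      simp only [C']
      linarith
    linarith
  · intro ν hν
    have h1 := (abs_le.1 (hexp u₀ hu₀.1 ν hν)).2
    have h2 := norm_le_add_inner_add_sq (y := P.residual ν u₀) hne
    have h3 := (hpert u₀ (hM u₀ hu₀.1) ν hν).2.1
    rw [← P.residual_sub, ← hx] at h3
    have h4 : ‖P.residual ν u₀ - x‖ ^ 2 ≤ C ^ 2 * (ν - ν₀) ^ 2 := by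
      rw [← sq_abs (ν - ν₀), ← mul_pow]
      gcongr
    have h5 := mul_le_mul_of_nonneg_left h4 (show 0 ≤ (2 * ‖x‖)⁻¹ by positivity)
    have h6 : 0 ≤ C * (ν - ν₀) ^ 2 := by positivity
    rw [f_eq, f_eq, ← hx]
    simp only [C']
    rw [← he] at h2
    rw [← hx] at h1
    linarith

/-- A control reaching the interior of the target ball would, by Lipschitz dependence on the
parameter, remain feasible for a slightly smaller `ν`. -/
theorem norm_residual_eq_of_isTimeOptimal {ν : ℝ} {u : Lp (Lp ℝ 2 ϱ) 2 volI}
    (hopt : P.IsTimeOptimal ν u) {v : Lp (Lp ℝ 2 ϱ) 2 volI} (hv : v ∈ P.UadI) :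
    P.δ₀ ≤ ‖P.residual ν v‖ := by
  by_contra! hlt
  have hν := hopt.1.1
  obtain ⟨r, C, hr, hC, hpert⟩ := P.exists_norm_S_sub_le hν ‖v‖
  let s := min (r / 2) ((P.δ₀ - ‖P.residual ν v‖) / (C + 1))
  have hs0 : 0 < s := lt_min (by positivity) (div_pos (by linarith) (by positivity))
  have hs1 : s < r := (min_le_left _ _).trans_lt (by linarith)
  have hs2 : s * (C + 1) ≤ P.δ₀ - ‖P.residual ν v‖ := by
    rw [← le_div_iff₀ (by positivity)]
    exact min_le_right _ _
  have habs : |ν - s - ν| = s := by rw [sub_sub_cancel_left, abs_neg, abs_of_pos hs0]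
  obtain ⟨h1, h2, -⟩ := hpert v le_rfl (ν - s) (by rwa [habs])
  rw [← P.residual_sub, habs] at h2
  have h3 : ‖P.residual (ν - s) v‖ ≤ P.δ₀ := by
    have := norm_le_norm_add_norm_sub' (P.residual (ν - s) v) (P.residual ν v)
    linarith
  have := hopt.2 _ v h1 hv h3
  linarith

/-- No smaller parameter is feasible, so `delta` is nonnegative to the left and nonpositive at `ν`;
left difference quotients are nonpositive. -/
theorem deriv_delta_nonpos {ν : ℝ} {u : Lp (Lp ℝ 2 ϱ) 2 volI} (hopt : P.IsTimeOptimal ν u)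
    {d : ℝ} (hd : HasDerivAt P.delta d ν) : d ≤ 0 := by
  have hν := hopt.1.1
  have hbdd : ∀ ν', BddBelow (P.f ν' '' P.UadI) := fun ν' => by
    refine ⟨-P.δ₀, ?_⟩
    rintro _ ⟨v, -, rfl⟩
    rw [f_eq]
    linarith [norm_nonneg (P.residual ν' v)]
  have h0 : P.delta ν ≤ 0 := by
    refine (csInf_le (hbdd ν) (mem_image_of_mem _ hopt.1.2.1)).trans ?_
    exact sub_nonpos.2 hopt.1.2.2
  have hpos : ∀ ν', 0 < ν' → ν' < ν → 0 ≤ P.delta ν' := by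
    intro ν' h1 h2
    refine le_csInf ⟨_, mem_image_of_mem _ hopt.1.2.1⟩ ?_
    rintro _ ⟨v, hv, rfl⟩
    by_contra! h3
    have := hopt.2 ν' v h1 hv (sub_neg.1 h3).le
    linarith
  have hslope := (hasDerivAt_iff_tendsto_slope_zero.1 hd).comp Trajectory.tendsto_neg_nhdsGT
  refine le_of_tendsto hslope ?_
  filter_upwards [Ioo_mem_nhdsGT hν] with h hh
  have h1 := hpos (ν + -h) (by linarith [hh.2]) (by linarith [hh.1])
  simp only [Function.comp_apply, smul_eq_mul]
  exact mul_nonpos_of_nonpos_of_nonneg (inv_nonpos.2 (by linarith [hh.1])) (by linarith)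

end ControlSystem

end MinimalDistance

end TimeOptimal

end

theorem mainTheorem9 {V H : Type*}
    [NormedAddCommGroup V] [InnerProductSpace ℝ V] [CompleteSpace V]
    [NormedAddCommGroup H] [InnerProductSpace ℝ H] [CompleteSpace H]
    {Ω : Type*} [MeasurableSpace Ω] {ϱ : MeasureTheory.Measure Ω}
    (P : TimeOptimal.ControlSystem V H ϱ)
    (hbdd : Bornology.IsBounded P.Uad)
    (νbar : ℝ) (ubar : MeasureTheory.Lp (MeasureTheory.Lp ℝ 2 ϱ) 2 TimeOptimal.volI)
    (hopt : P.IsTimeOptimal νbar ubar)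
    (hind : P.ControlIndependent νbar) :
    DifferentiableAt ℝ P.delta νbar ∧
      (P.QualifiedConditions νbar ubar ↔ deriv P.delta νbar ≠ 0) := by
  have hν := hopt.1.1
  have hterm : ‖P.residual νbar ubar‖ = P.δ₀ :=
    le_antisymm hopt.1.2.2 (P.norm_residual_eq_of_isTimeOptimal hopt hopt.1.2.1)
  have hdist : ubar ∈ P.distanceOptimal νbar :=
    ⟨hopt.1.2.1, fun v hv => hterm.le.trans (P.norm_residual_eq_of_isTimeOptimal hopt hv)⟩
  have hδ := P.δ₀_pos
  have hne : P.residual νbar ubar ≠ 0 := by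
    rw [← norm_pos_iff, hterm]
    exact hδ
  have hder := P.hasDerivAt_delta hbdd hν hdist hne hind
  have hnonpos := P.deriv_delta_nonpos hopt hder
  -- The residual has norm `δ₀`, so the terminal value with multiplier `μ` is `μ δ₀` times the
  -- normalized one.
  have hscale : ∀ μ : ℝ,
      P.hamiltonian νbar ubar (P.adjointState νbar (μ • ((P.S νbar ubar).rep 1 - P.yd))) =
        μ * P.δ₀ * P.hamiltonian νbar ubar (P.normalizedAdjoint νbar ubar) := by
    intro μ
    have h1 : μ • ((P.S νbar ubar).rep 1 - P.yd) = (μ * P.δ₀) •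
        (‖(P.S νbar ubar).rep 1 - P.yd‖⁻¹ • ((P.S νbar ubar).rep 1 - P.yd)) := by
      have h2 : ‖(P.S νbar ubar).rep 1 - P.yd‖ = P.δ₀ := hterm
      rw [smul_smul, h2, mul_assoc, mul_inv_cancel₀ hδ.ne', mul_one]
    rw [h1, P.hamiltonian_eq_inner, P.hamiltonian_eq_inner, P.valLp_adjointState_smul hν,
      real_inner_smul_right]
    rfl
  refine ⟨hder.differentiableAt, ?_⟩
  rw [hder.deriv]
  constructor
  · rintro ⟨μ, -, hμ⟩ h0
    have h1 := hμ.hamiltonian_eq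
    rw [hscale, h0, mul_zero] at h1
    linarith
  · intro h0
    have hneg := lt_of_le_of_ne hnonpos h0
    set d := P.hamiltonian νbar ubar (P.normalizedAdjoint νbar ubar)
    -- The only solution of `μ δ₀ d = -1`, positive because `d < 0`.
    refine ⟨(P.δ₀ * -d)⁻¹, inv_pos.2 (mul_pos hδ (neg_pos.2 hneg)), ?_, ?_, hterm⟩
    · rw [hscale]
      field_simp
    · intro v hv
      rw [P.integral_Badj_eq_inner]
      have h1 := P.inner_S_sub_control hν v ubar (P.isAdjoint_adjointState hν
        ((P.δ₀ * -d)⁻¹ • ((P.S νbar ubar).rep 1 - P.yd)))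
      have h2 := P.inner_residual_sub_nonneg hν hdist hv
      rw [P.residual_sub] at h2
      rw [real_inner_smul_right] at h1
      have h3 : 0 ≤ (P.δ₀ * -d)⁻¹ *
          inner ℝ ((P.S νbar v).rep 1 - (P.S νbar ubar).rep 1) ((P.S νbar ubar).rep 1 - P.yd) :=
        mul_nonneg (inv_nonneg.2 (mul_pos hδ (neg_pos.2 hneg)).le) h2
      rw [h1] at h3
      exact nonneg_of_mul_nonneg_right h3 hν
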